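/- **The game $\mathrm{TLP}(\kappa,\rho)$.** Let $\kappa\in(0,1]$, $\rho\in(0,\infty)$, and let $m_{-\infty},m_\infty,n_{-\infty},n_\infty,m_*,n_*\in\mathbb{R}$ satisfy $m_{-\infty}<m_\infty$, $n_\infty<n_{-\infty}$, $m_*<m_{-\infty}$ and $n_*<n_\infty$. A counter $X:\mathbb{N}\to\mathbb{Z}$ starts at $X(0)=\ell\in\mathbb{Z}$. Let $\Lambda_k$ be the set of paths $\psi:\{0,\dots,k\}\to\mathbb{Z}$ with $|\psi(j+1)-\psi(j)|=1$ for $0\le j<k$. A strategy is a map $S:\Lambda=\bigcup_{k\ge0}\Lambda_k\to[0,\infty)$; it is time-invariant if $S(\psi)$ depends only on the terminal value of $\psi$. If Mina plays $S_-$ and Maxine plays $S_+$, then at turn $k+1$, $k\ge0$, they stake $b=S_-(X|_{\{0,\dots,k\}})$ and $a=S_+(X|_{\{0,\dots,k\}})$, and, given the history, $X(k+1)=X(k)+1$ with probability $\kappa\frac{a^\rho}{a^\rho+b^\rho}+\frac{1-\kappa}{2}$ (the fraction being read as $\frac12$ when $a=b=0$), and $X(k+1)=X(k)-1$ otherwise.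 Let $\mathbb{E}^\ell_{S_-,S_+}$ denote expectation under the resulting law of $X$. Maxine's and Mina's terminal payments $(T_+,T_-)$ are $(m_\infty,n_\infty)$ if $X(k)\to\infty$, $(m_{-\infty},n_{-\infty})$ if $X(k)\to-\infty$, and $(m_*,n_*)$ otherwise. Their net receipts are $P_\pm=T_\pm-\sum_{k\ge0}S_\pm(X|_{\{0,\dots,k\}})$, whose means lie in $[-\infty,\infty)$. The pair $(S_-,S_+)$ is a Nash equilibrium if, for every strategy $S$ (time-invariant or not) and every $\ell\in\mathbb{Z}$, $$\mathbb{E}^\ell_{S_-,S_+}[P_+]\ge\mathbb{E}^\ell_{S_-,S}[P_+]\quad\text{and}\quad\mathbb{E}^\ell_{S_-,S_+}[P_-]\ge\mathbb{E}^\ell_{S,S_+}[P_-].$$ To a pair $(S_-,S_+)$ of time-invariant strategies associate the quadruple $(a_i,b_i,m_i,n_i)_{i\in\mathbb{Z}}$ in which $a_i$ and $b_i$ are the stakes that $S_+$ and $S_-$ dictate when the counter is at $i$, $m_i=\mathbb{E}^i_{S_-,S_+}[P_+]$ and $n_i=\mathbb{E}^i_{S_-,S_+}[P_-]$. Conversely,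 sequences $a,b:\mathbb{Z}\to[0,\infty)$ determine such a pair $(S_-,S_+)$. **The system $\mathrm{ABMN}(\kappa,\rho)$** is the set of equations, for $(a_i,b_i,m_i,n_i)\in(0,\infty)^2\times\mathbb{R}^2$ and all $i\in\mathbb{Z}$, $$\begin{aligned} 2(a_i^\rho+b_i^\rho)(m_i+a_i)&=\big(a_i^\rho(1-\kappa)+b_i^\rho(1+\kappa)\big)m_{i-1}+\big(a_i^\rho(1+\kappa)+b_i^\rho(1-\kappa)\big)m_{i+1},\\ 2(a_i^\rho+b_i^\rho)(n_i+b_i)&=\big(a_i^\rho(1-\kappa)+b_i^\rho(1+\kappa)\big)n_{i-1}+\big(a_i^\rho(1+\kappa)+b_i^\rho(1-\kappa)\big)n_{i+1},\\ (a_i^\rho+b_i^\rho)^2&=\rho\kappa\,a_i^{\rho-1}b_i^\rho\,(m_{i+1}-m_{i-1}),\\ (a_i^\rho+b_i^\rho)^2&=\rho\kappa\,a_i^\rho b_i^{\rho-1}\,(n_{i-1}-n_{i+1}). \end{aligned}$$ A solution has boundary data $(m_{-\infty},m_\infty,n_{-\infty},n_\infty)$ if $m_i\to m_{\pm\infty}$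 and $n_i\to n_{\pm\infty}$ as $i\to\pm\infty$. **Theorem.** Suppose in addition that $\rho\le1$. 1. If a pair $(S_-,S_+)$ of time-invariant strategies is a Nash equilibrium, then $m_i$ and $n_i$ in its associated quadruple are finite, and the quadruple solves $\mathrm{ABMN}(\kappa,\rho)$ with boundary data $(m_{-\infty},m_\infty,n_{-\infty},n_\infty)$. 2. Conversely, if $(a,b,m,n)$ is a solution of $\mathrm{ABMN}(\kappa,\rho)$ with boundary data $(m_{-\infty},m_\infty,n_{-\infty},n_\infty)$, then the pair $(S_-,S_+)$ of time-invariant strategies that stake $b_i$ and $a_i$ respectively whenever the counter is at $i$ is a Nash equilibrium. -/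

import Mathlib

open Filter Topology MeasureTheory ProbabilityTheory
open scoped NNReal ENNReal

/-- The data of a game `TLP(κ, ρ)`: the parameters `κ ∈ (0,1]` and `ρ ∈ (0,∞)`, the terminal payments
to Maxine (`m`) and to Mina (`n`) at left escape, at right escape and when the game is unfinished. -/
structure TrailGame where
  κ : ℝ
  ρ : ℝ
  mNegInf : ℝ
  mPosInf : ℝ
  nNegInf : ℝ
  nPosInf : ℝ
  mStar : ℝ
  nStar : ℝ
  κ_pos : 0 < κ
  κ_le_one : κ ≤ 1
  ρ_pos : 0 < ρ
  m_lt : mNegInf < mPosInf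
  n_lt : nPosInf < nNegInf
  mStar_lt : mStar < mNegInf
  nStar_lt : nStar < nPosInf

/-- `Λ_k`: the paths `ψ : {0, …, k} → ℤ` with steps `±1`. -/
def TrailPath (k : ℕ) : Type :=
  {ψ : Finset.Iic k → ℤ //
    ∀ i j : Finset.Iic k, (j : ℕ) = (i : ℕ) + 1 → |ψ j - ψ i| = 1}

/-- The last index of a path of length `k`. -/
def lastIndex (k : ℕ) : Finset.Iic k := ⟨k, Finset.mem_Iic.2 le_rfl⟩

/-- The terminal value `ψ(k)` of a path `ψ ∈ Λ_k`. -/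
def TrailPath.terminal {k : ℕ} (ψ : TrailPath k) : ℤ := ψ.1 (lastIndex k)

/-- A (deterministic, history-dependent) strategy: a non-negative stake for every path in
`Λ = ⋃ₖ Λ_k`; the value at `ψ ∈ Λ_k` is the stake offered at turn `k + 1` when the counter's history
is `ψ`. -/
def Strategy : Type := (k : ℕ) → TrailPath k → ℝ≥0

namespace Strategy

/-- The time-invariant strategy that stakes `s i` whenever the counter is at `i`. -/
def ofProfile (s : ℤ → ℝ≥0) : Strategy := fun _ ψ => s ψ.terminal

/-- Time-invariance: the value on every path is determined by the terminal value of the path. -/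
def IsTimeInvariant (S : Strategy) : Prop :=
  ∀ (k l : ℕ) (ψ : TrailPath k) (χ : TrailPath l), ψ.terminal = χ.terminal → S k ψ = S l χ

open Classical in
/-- The stake at turn `k + 1` for the counter history `h`. Histories with a step other than `±1`
never occur in the game; for them the value is immaterial and set to zero. -/
noncomputable def stake (S : Strategy) (k : ℕ) (h : Finset.Iic k → ℤ) : ℝ≥0 :=
  if hp : ∀ i j : Finset.Iic k, (j : ℕ) = (i : ℕ) + 1 → |h j - h i| = 1 then S k ⟨h, hp⟩ else 0

/-- The total running cost `∑ₖ S(k)` along the counter trajectory `X`. -/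
noncomputable def cost (S : Strategy) (X : ℕ → ℤ) : ℝ≥0∞ :=
  ∑' k : ℕ, (S.stake k (fun i => X i) : ℝ≥0∞)

end Strategy

/-- The probability that Maxine wins a stake turn when she stakes `a` and Mina stakes `b`. -/
noncomputable def contestProb (ρ : ℝ) (a b : ℝ≥0) : ℝ :=
  if a = 0 ∧ b = 0 then 1 / 2 else (a : ℝ) ^ ρ / ((b : ℝ) ^ ρ + (a : ℝ) ^ ρ)

lemma contestProb_nonneg (ρ : ℝ) (a b : ℝ≥0) : 0 ≤ contestProb ρ a b := by
  unfold contestProb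
  split_ifs
  · norm_num
  · positivity

lemma contestProb_le_one (ρ : ℝ) (a b : ℝ≥0) : contestProb ρ a b ≤ 1 := by
  unfold contestProb
  split_ifs
  · norm_num
  · refine div_le_one_of_le₀ ?_ (by positivity)
    have : (0 : ℝ) ≤ (b : ℝ) ^ ρ := by positivity
    linarith

namespace TrailGame

/-- The probability that Maxine wins a turn in which she stakes `a` and Mina stakes `b`: with
probability `κ` the turn is `stake`, otherwise it is `flip`. -/
noncomputable def rightProb (G : TrailGame) (a b : ℝ≥0) : ℝ :=
  G.κ * contestProb G.ρ a b + (1 - G.κ) * (1 / 2)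

lemma rightProb_nonneg (G : TrailGame) (a b : ℝ≥0) : 0 ≤ G.rightProb a b :=
  add_nonneg (mul_nonneg G.κ_pos.le (contestProb_nonneg _ _ _))
    (mul_nonneg (sub_nonneg.2 G.κ_le_one) (by norm_num))

lemma rightProb_le_one (G : TrailGame) (a b : ℝ≥0) : G.rightProb a b ≤ 1 := by
  have h1 : G.κ * contestProb G.ρ a b ≤ G.κ * 1 :=
    mul_le_mul_of_nonneg_left (contestProb_le_one _ _ _) G.κ_pos.le
  have h2 := G.κ_le_one
  unfold rightProb
  linarith

/-- The law of the counter's next location, when it is at `x` and Maxine and Mina stake `a` and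
`b`. -/
noncomputable def moveLaw (G : TrailGame) (a b : ℝ≥0) (x : ℤ) : Measure ℤ :=
  ENNReal.ofReal (G.rightProb a b) • Measure.dirac (x + 1) +
    ENNReal.ofReal (1 - G.rightProb a b) • Measure.dirac (x - 1)

instance (G : TrailGame) (a b : ℝ≥0) (x : ℤ) : IsProbabilityMeasure (G.moveLaw a b x) := by
  constructor
  have h := G.rightProb_le_one a b
  simp only [moveLaw, Measure.coe_add, Measure.coe_smul, Pi.add_apply, Pi.smul_apply,
    measure_univ, smul_eq_mul, mul_one]
  rw [← ENNReal.ofReal_add (G.rightProb_nonneg a b) (by linarith)]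
  simp

/-- The transition kernel of turn `k + 1`, from counter histories `X(0), …, X(k)` to `X(k + 1)`, when
Mina plays `Sm` and Maxine plays `Sp`. -/
noncomputable def turnKernel (G : TrailGame) (Sm Sp : Strategy) (k : ℕ) :
    Kernel (Finset.Iic k → ℤ) ℤ :=
  Kernel.ofFunOfCountable fun h => G.moveLaw (Sp.stake k h) (Sm.stake k h) (h (lastIndex k))

instance (G : TrailGame) (Sm Sp : Strategy) (k : ℕ) : IsMarkovKernel (G.turnKernel Sm Sp k) :=
  ⟨fun h => inferInstanceAs
    (IsProbabilityMeasure (G.moveLaw (Sp.stake k h) (Sm.stake k h) (h (lastIndex k))))⟩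

/-- The law of the counter evolution `X : ℕ → ℤ` under the strategy pair `(Sm, Sp)` with
`X(0) = ℓ`. -/
noncomputable def gameLaw (G : TrailGame) (Sm Sp : Strategy) (l : ℤ) : Measure (ℕ → ℤ) :=
  Kernel.traj (X := fun _ => ℤ) (G.turnKernel Sm Sp) 0 (fun _ => l)

open Classical in
/-- Maxine's terminal payment `T₊`. -/
noncomputable def terminalMaxine (G : TrailGame) (X : ℕ → ℤ) : ℝ :=
  if Tendsto X atTop atTop then G.mPosInf
  else if Tendsto X atTop atBot then G.mNegInf
  else G.mStar

open Classical in
/-- Mina's terminal payment `T₋`. -/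
noncomputable def terminalMina (G : TrailGame) (X : ℕ → ℤ) : ℝ :=
  if Tendsto X atTop atTop then G.nPosInf
  else if Tendsto X atTop atBot then G.nNegInf
  else G.nStar

/-- Maxine's mean net receipt `E[P₊] = E[T₊ - C₊] = E[T₊] - E[C₊]` in `[-∞, ∞)`; the terminal payment
is bounded, and the running cost is non-negative with mean in `[0, ∞]`. -/
noncomputable def meanMaxine (G : TrailGame) (Sm Sp : Strategy) (l : ℤ) : EReal :=
  ((∫ X, G.terminalMaxine X ∂(G.gameLaw Sm Sp l) : ℝ) : EReal) -
    ((∫⁻ X, Sp.cost X ∂(G.gameLaw Sm Sp l) : ℝ≥0∞) : EReal)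

/-- Mina's mean net receipt `E[P₋] = E[T₋ - C₋] = E[T₋] - E[C₋]` in `[-∞, ∞)`. -/
noncomputable def meanMina (G : TrailGame) (Sm Sp : Strategy) (l : ℤ) : EReal :=
  ((∫ X, G.terminalMina X ∂(G.gameLaw Sm Sp l) : ℝ) : EReal) -
    ((∫⁻ X, Sm.cost X ∂(G.gameLaw Sm Sp l) : ℝ≥0∞) : EReal)

/-- `(Sm, Sp)` is a Nash equilibrium: from no starting location does either player gain in mean by a
unilateral deviation to any strategy. -/
def IsNash (G : TrailGame) (Sm Sp : Strategy) : Prop :=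
  ∀ (S : Strategy) (l : ℤ),
    G.meanMaxine Sm S l ≤ G.meanMaxine Sm Sp l ∧ G.meanMina S Sp l ≤ G.meanMina Sm Sp l

end TrailGame

/-- A quadruple `(a, b, m, n) : ℤ → [0,∞)² × ℝ²`. -/
structure Quadruple where
  a : ℤ → ℝ≥0
  b : ℤ → ℝ≥0
  m : ℤ → ℝ
  n : ℤ → ℝ

namespace Quadruple

/-- `q` is the quadruple associated to the strategy pair `(Sm, Sp)`: Maxine always stakes `a i` and
Mina `b i` when the counter is at `i`, and `m i`, `n i` are their mean net receipts (in particular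
these are finite) when it starts at `i`. -/
structure IsAssociated (G : TrailGame) (Sm Sp : Strategy) (q : Quadruple) : Prop where
  a_eq : ∀ (k : ℕ) (ψ : TrailPath k), q.a ψ.terminal = Sp k ψ
  b_eq : ∀ (k : ℕ) (ψ : TrailPath k), q.b ψ.terminal = Sm k ψ
  m_eq : ∀ i : ℤ, (q.m i : EReal) = G.meanMaxine Sm Sp i
  n_eq : ∀ i : ℤ, (q.n i : EReal) = G.meanMina Sm Sp i

/-- `q` solves the `ABMN(κ, ρ)` system on `ℤ`, in positive `a` and `b`. -/
structure IsABMN (κ ρ : ℝ) (q : Quadruple) : Prop where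
  a_pos : ∀ i, 0 < q.a i
  b_pos : ∀ i, 0 < q.b i
  eq1 : ∀ i, 2 * ((q.a i : ℝ) ^ ρ + (q.b i : ℝ) ^ ρ) * (q.m i + q.a i) =
    ((q.a i : ℝ) ^ ρ * (1 - κ) + (q.b i : ℝ) ^ ρ * (1 + κ)) * q.m (i - 1) +
      ((q.a i : ℝ) ^ ρ * (1 + κ) + (q.b i : ℝ) ^ ρ * (1 - κ)) * q.m (i + 1)
  eq2 : ∀ i, 2 * ((q.a i : ℝ) ^ ρ + (q.b i : ℝ) ^ ρ) * (q.n i + q.b i) =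
    ((q.a i : ℝ) ^ ρ * (1 - κ) + (q.b i : ℝ) ^ ρ * (1 + κ)) * q.n (i - 1) +
      ((q.a i : ℝ) ^ ρ * (1 + κ) + (q.b i : ℝ) ^ ρ * (1 - κ)) * q.n (i + 1)
  eq3 : ∀ i, ((q.a i : ℝ) ^ ρ + (q.b i : ℝ) ^ ρ) ^ 2 =
    ρ * κ * (q.a i : ℝ) ^ (ρ - 1) * (q.b i : ℝ) ^ ρ * (q.m (i + 1) - q.m (i - 1))
  eq4 : ∀ i, ((q.a i : ℝ) ^ ρ + (q.b i : ℝ) ^ ρ) ^ 2 =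
    ρ * κ * (q.a i : ℝ) ^ ρ * (q.b i : ℝ) ^ (ρ - 1) * (q.n (i - 1) - q.n (i + 1))

/-- `q` has the boundary data of the game `G`. -/
structure HasBoundaryData (G : TrailGame) (q : Quadruple) : Prop where
  m_neg : Tendsto q.m atBot (𝓝 G.mNegInf)
  m_pos : Tendsto q.m atTop (𝓝 G.mPosInf)
  n_neg : Tendsto q.n atBot (𝓝 G.nNegInf)
  n_pos : Tendsto q.n atTop (𝓝 G.nPosInf)

end Quadruple

/-! ### The law of the counter: one-step identity, starting point, unit steps. -/

open Preorder

namespace TrailGame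

/-! Both directions pass through a local condition, `IsBestReply`: at each site, each player's stake
maximises the mean of the value at the next site minus the stake. The first two ABMN equations say
that the values satisfy this one-turn recursion (`step_eq_iff`), and the last two are the
first-order conditions. For `ρ ≤ 1` the winning probability is strictly concave in the player's own
stake to the power `ρ`, and that power is concave in the stake. So the first-order condition is
sufficient, and the optimum is unique (`contestProb_mul_sub_lt`).

From ABMN to Nash is a verification argument. Against the opponent's profile, and whatever a player
stakes, the value at the counter minus the stakes paid so far is a supermartingale. Fatou's lemma
bounds the mean net receipt by the initial value (`netMean_le`): on escape the values tend to the
terminal payments, and the payment for an unfinished game lies below every value. Under the profiles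
themselves the value is a bounded submartingale with positive drift at every site, so the counter
escapes almost surely (`ae_escape`) and the bound is attained (`netMean_profileLaw_eq`).

From Nash to ABMN, deviations at the first turn only, together with the Markov property, give best
replies at every site. A positive stake is never optimal against zero, so the two stakes at a site
vanish together. Across a site with positive stakes Maxine's value strictly rises, and across a site
with zero stakes it does not, so either all stakes vanish or none does. If all vanished, summable
positive stakes would let either player secure nearly the best payment, and both would have to
receive it. So all stakes are positive, and ABMN follows.

For the boundary data, each stake is at most an increment of its owner's monotone value. Doubling
the opponent's stakes is therefore affordable and gives winning probability bounded above 1/2, which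
identifies each player's limit on the winning side (`exists_potential`). If a limit on the losing
side were wrong, that escape would be null from every start, which contradicts the other player's
limit there. -/

instance (G : TrailGame) (Sm Sp : Strategy) (l : ℤ) : IsProbabilityMeasure (G.gameLaw Sm Sp l) :=
  inferInstanceAs (IsProbabilityMeasure
    (Kernel.traj (X := fun _ => ℤ) (G.turnKernel Sm Sp) 0 (fun _ => l)))

lemma lintegral_moveLaw (G : TrailGame) (a b : ℝ≥0) (x : ℤ) (f : ℤ → ℝ≥0∞) :
    ∫⁻ y, f y ∂(G.moveLaw a b x) =
      ENNReal.ofReal (G.rightProb a b) * f (x + 1) +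
        ENNReal.ofReal (1 - G.rightProb a b) * f (x - 1) := by
  rw [moveLaw, lintegral_add_measure, lintegral_smul_measure, lintegral_smul_measure,
    lintegral_dirac, lintegral_dirac]
  rfl

/-- The one-step identity for the law of the counter. -/
lemma lintegral_gameLaw_succ (G : TrailGame) (Sm Sp : Strategy) (l : ℤ) (k : ℕ)
    (f : (Finset.Iic k → ℤ) → ℤ → ℝ≥0∞) :
    ∫⁻ X, f (frestrictLe k X) (X (k + 1)) ∂(G.gameLaw Sm Sp l) =
      ∫⁻ X, (ENNReal.ofReal (G.rightProb (Sp.stake k (frestrictLe k X))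
            (Sm.stake k (frestrictLe k X))) * f (frestrictLe k X) (X k + 1) +
          ENNReal.ofReal (1 - G.rightProb (Sp.stake k (frestrictLe k X))
            (Sm.stake k (frestrictLe k X))) * f (frestrictLe k X) (X k - 1))
        ∂(G.gameLaw Sm Sp l) := by
  have h := Kernel.partialTraj_compProd_eq_map_traj (X := fun _ => ℤ)
    (κ := G.turnKernel Sm Sp) (Nat.zero_le k) (x₀ := fun _ => l)
  have hm : Measurable (Function.uncurry f) := measurable_of_countable _
  have h1 : ∫⁻ X, f (frestrictLe k X) (X (k + 1)) ∂(G.gameLaw Sm Sp l) =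
      ∫⁻ z, Function.uncurry f z ∂((G.gameLaw Sm Sp l).map
        (fun x => (frestrictLe k x, x (k + 1)))) := by
    rw [lintegral_map hm (by fun_prop)]
    rfl
  rw [h1, gameLaw, ← h, Measure.lintegral_compProd hm,
    ← Kernel.traj_map_frestrictLe_apply, lintegral_map (measurable_of_countable _) (by fun_prop)]
  refine lintegral_congr fun X => ?_
  exact G.lintegral_moveLaw _ _ _ _

lemma gameLaw_map_zero (G : TrailGame) (Sm Sp : Strategy) (l : ℤ) :
    (G.gameLaw Sm Sp l).map (fun X => X 0) = Measure.dirac l := by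
  have h := Kernel.traj_map_frestrictLe_apply (X := fun _ => ℤ)
    (κ := G.turnKernel Sm Sp) 0 0 (fun _ => l)
  have h2 : (fun X : ℕ → ℤ => X 0) = (fun h : Finset.Iic 0 → ℤ => h (lastIndex 0)) ∘
    (frestrictLe 0 : (ℕ → ℤ) → _) := rfl
  rw [h2, ← Measure.map_map (by fun_prop) (by fun_prop), gameLaw, h, Kernel.partialTraj_self,
    Kernel.id_apply]
  exact Measure.map_dirac' (measurable_of_countable _) _

lemma ae_gameLaw_zero (G : TrailGame) (Sm Sp : Strategy) (l : ℤ) :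
    ∀ᵐ X ∂(G.gameLaw Sm Sp l), X 0 = l := by
  have h : ∀ᵐ x ∂((G.gameLaw Sm Sp l).map (fun X => X 0)), x = l := by
    rw [gameLaw_map_zero]
    simp [ae_dirac_eq]
  exact ae_of_ae_map (measurable_pi_apply 0).aemeasurable h

lemma ae_gameLaw_step (G : TrailGame) (Sm Sp : Strategy) (l : ℤ) :
    ∀ᵐ X ∂(G.gameLaw Sm Sp l), ∀ k, |X (k + 1) - X k| = 1 := by
  rw [ae_all_iff]
  intro k
  -- The one-step identity is applied to the indicator of an illegal step, which both possible moves
  -- avoid.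
  have h := G.lintegral_gameLaw_succ Sm Sp l k
    (fun h y => if |y - h (lastIndex k)| = 1 then 0 else 1)
  have h0 : ∀ X : ℕ → ℤ, (frestrictLe k X : Finset.Iic k → ℤ) (lastIndex k) = X k := fun _ => rfl
  simp only [h0, add_sub_cancel_left, sub_sub_cancel_left, abs_neg, abs_one, if_true, mul_zero,
    add_zero, lintegral_zero] at h
  rw [lintegral_eq_zero_iff] at h
  · filter_upwards [h] with X hX
    by_contra hc
    simp [hc] at hX
  · exact (measurable_of_countable (fun z : ℤ × ℤ => if |z.1 - z.2| = 1 then (0 : ℝ≥0∞) else 1)).comp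
      (by fun_prop : Measurable fun X : ℕ → ℤ => (X (k + 1), X k))

end TrailGame

namespace Strategy

lemma stake_frestrictLe (S : Strategy) {X : ℕ → ℤ} (hX : ∀ k, |X (k + 1) - X k| = 1) (k : ℕ) :
    ∃ ψ : TrailPath k, ψ.terminal = X k ∧ S.stake k (frestrictLe k X) = S k ψ := by
  have hv : ∀ i j : Finset.Iic k, (j : ℕ) = (i : ℕ) + 1 →
      |(frestrictLe k X : Finset.Iic k → ℤ) j - (frestrictLe k X : Finset.Iic k → ℤ) i| = 1 := by
    intro i j hij
    simp only [frestrictLe_apply, hij]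
    exact hX i
  refine ⟨⟨frestrictLe k X, hv⟩, rfl, ?_⟩
  rw [stake, dif_pos hv]

lemma stake_of_forall (S : Strategy) (s : ℤ → ℝ≥0) {X : ℕ → ℤ}
    (hX : ∀ k, |X (k + 1) - X k| = 1) (k : ℕ) (hS : ∀ ψ : TrailPath k, S k ψ = s ψ.terminal) :
    S.stake k (frestrictLe k X) = s (X k) := by
  obtain ⟨ψ, h1, h2⟩ := S.stake_frestrictLe hX k
  rw [h2, hS, h1]

lemma stake_ofProfile (s : ℤ → ℝ≥0) {X : ℕ → ℤ} (hX : ∀ k, |X (k + 1) - X k| = 1) (k : ℕ) :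
    (ofProfile s).stake k (frestrictLe k X) = s (X k) :=
  stake_of_forall _ s hX k fun _ => rfl

lemma measurable_stake (S : Strategy) (k : ℕ) :
    Measurable fun X : ℕ → ℤ => (S.stake k (frestrictLe k X) : ℝ≥0∞) :=
  (measurable_of_countable (fun h : Finset.Iic k → ℤ => (S.stake k h : ℝ≥0∞))).comp
    (measurable_frestrictLe k)

lemma measurable_cost (S : Strategy) : Measurable S.cost :=
  Measurable.tsum fun k => S.measurable_stake k

lemma lintegral_cost (S : Strategy) (μ : Measure (ℕ → ℤ)) :
    ∫⁻ X, S.cost X ∂μ = ∑' k, ∫⁻ X, (S.stake k (frestrictLe k X) : ℝ≥0∞) ∂μ :=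
  lintegral_tsum fun k => (S.measurable_stake k).aemeasurable

end Strategy

/-! ### Terminal payments, mean net receipts, and escape of integer paths. -/

open Classical in
/-- The terminal payment of `r` at right escape, `s` at left escape and `t` otherwise. -/
noncomputable def terminalPay (r s t : ℝ) (X : ℕ → ℤ) : ℝ :=
  if Tendsto X atTop atTop then r
  else if Tendsto X atTop atBot then s
  else t

lemma measurableSet_tendsto_atTop : MeasurableSet {X : ℕ → ℤ | Tendsto X atTop atTop} :=
  measurableSet_tendsto atTop fun k => measurable_pi_apply k

lemma measurableSet_tendsto_atBot : MeasurableSet {X : ℕ → ℤ | Tendsto X atTop atBot} :=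
  measurableSet_tendsto atBot fun k => measurable_pi_apply k

lemma measurable_terminalPay (r s t : ℝ) : Measurable (terminalPay r s t) :=
  Measurable.ite measurableSet_tendsto_atTop measurable_const
    (Measurable.ite measurableSet_tendsto_atBot measurable_const measurable_const)

lemma terminalPay_of_atTop (r s t : ℝ) {X : ℕ → ℤ} (h : Tendsto X atTop atTop) :
    terminalPay r s t X = r := if_pos h

lemma terminalPay_of_atBot (r s t : ℝ) {X : ℕ → ℤ} (h : Tendsto X atTop atBot) :
    terminalPay r s t X = s := by
  have h' : ¬ Tendsto X atTop atTop := fun h' => h'.not_tendsto (disjoint_atTop_atBot) h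
  rw [terminalPay, if_neg h', if_pos h]

lemma terminalPay_mem (r s t : ℝ) {A : Set ℝ} (hr : r ∈ A) (hs : s ∈ A) (ht : t ∈ A) (X : ℕ → ℤ) :
    terminalPay r s t X ∈ A := by
  unfold terminalPay
  split_ifs <;> assumption

lemma exists_abs_terminalPay_le (r s t : ℝ) : ∃ B, ∀ X, |terminalPay r s t X| ≤ B :=
  ⟨max |r| (max |s| |t|), terminalPay_mem r s t (A := {x | |x| ≤ max |r| (max |s| |t|)})
    (by simp) (by simp) (by simp)⟩

lemma integrable_terminalPay (r s t : ℝ) (μ : Measure (ℕ → ℤ)) [IsFiniteMeasure μ] :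
    Integrable (terminalPay r s t) μ := by
  obtain ⟨B, hB⟩ := exists_abs_terminalPay_le r s t
  exact Integrable.of_bound (measurable_terminalPay r s t).aestronglyMeasurable B
    (ae_of_all _ hB)

/-- The mean in `[-∞, ∞)` of the payment `T` minus the running cost of `S`. -/
noncomputable def netMean (μ : Measure (ℕ → ℤ)) (T : (ℕ → ℤ) → ℝ) (S : Strategy) : EReal :=
  ((∫ X, T X ∂μ : ℝ) : EReal) - ((∫⁻ X, S.cost X ∂μ : ℝ≥0∞) : EReal)

lemma TrailGame.meanMaxine_eq (G : TrailGame) (Sm Sp : Strategy) (l : ℤ) :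
    G.meanMaxine Sm Sp l =
      netMean (G.gameLaw Sm Sp l) (terminalPay G.mPosInf G.mNegInf G.mStar) Sp := rfl

lemma TrailGame.meanMina_eq (G : TrailGame) (Sm Sp : Strategy) (l : ℤ) :
    G.meanMina Sm Sp l =
      netMean (G.gameLaw Sm Sp l) (terminalPay G.nPosInf G.nNegInf G.nStar) Sm := rfl

lemma exists_abs_le_of_tendsto {u : ℤ → ℝ} {r s : ℝ} (hr : Tendsto u atTop (𝓝 r))
    (hs : Tendsto u atBot (𝓝 s)) : ∃ B, ∀ i, |u i| ≤ B := by
  have h1 : ∀ᶠ i in atTop, |u i| ≤ |r| + 1 :=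
    (hr.abs.eventually_lt_const (lt_add_one _)).mono fun _ h => h.le
  have h2 : ∀ᶠ i in atBot, |u i| ≤ |s| + 1 :=
    (hs.abs.eventually_lt_const (lt_add_one _)).mono fun _ h => h.le
  obtain ⟨N, hN⟩ := eventually_atTop.1 h1
  obtain ⟨M, hM⟩ := eventually_atBot.1 h2
  have hsum : 0 ≤ ∑ j ∈ Finset.Icc M N, |u j| := Finset.sum_nonneg fun _ _ => abs_nonneg _
  refine ⟨(|r| + 1) + (|s| + 1) + ∑ j ∈ Finset.Icc M N, |u j|, fun i => ?_⟩
  have := abs_nonneg r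
  have := abs_nonneg s
  by_cases hi : i ∈ Finset.Icc M N
  · have := Finset.single_le_sum (f := fun j => |u j|) (fun _ _ => abs_nonneg _) hi
    linarith
  · rw [Finset.mem_Icc, not_and_or] at hi
    rcases hi with hi | hi
    · have := hM i (by omega)
      linarith
    · have := hN i (by omega)
      linarith

/-- A nearest-neighbour sequence of integers that visits every site finitely often escapes. -/
lemma tendsto_atTop_or_atBot_of_cofinite {X : ℕ → ℤ} (hX : ∀ k, |X (k + 1) - X k| = 1)
    (h : Tendsto X atTop cofinite) : Tendsto X atTop atTop ∨ Tendsto X atTop atBot := by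
  have h0 : ∀ᶠ k in atTop, X k ≠ 0 := h.eventually (eventually_cofinite_ne 0)
  obtain ⟨N, hN⟩ := eventually_atTop.1 h0
  rw [Int.cofinite_eq] at h
  have hstep : ∀ k, X (k + 1) = X k + 1 ∨ X (k + 1) = X k - 1 := fun k => by
    have := hX k
    rcases (abs_eq (zero_le_one)).1 this with h | h
    · left; omega
    · right; omega
  -- Unit steps cannot cross 0 without visiting it, so the sign is constant from time `N` on.
  rcases lt_or_gt_of_ne (hN N le_rfl) with hs | hs
  · right
    have hneg : ∀ k ≥ N, X k < 0 := by
      intro k hk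
      induction k, hk using Nat.le_induction with
      | base => exact hs
      | succ k hk ih =>
        have h1 := hN (k + 1) (by omega)
        rcases hstep k with h2 | h2 <;> omega
    rw [tendsto_atBot]
    intro b
    have h3 : ∀ᶠ x in (atBot ⊔ atTop : Filter ℤ), x ≤ b ∨ 0 ≤ x :=
      eventually_sup.2 ⟨(eventually_le_atBot b).mono fun _ => Or.inl,
        (eventually_ge_atTop 0).mono fun _ => Or.inr⟩
    filter_upwards [h.eventually h3, eventually_ge_atTop N] with k hk hkN
    rcases hk with hk | hk
    · exact hk
    · exact absurd (hneg k hkN) (by omega)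
  · left
    have hpos : ∀ k ≥ N, 0 < X k := by
      intro k hk
      induction k, hk using Nat.le_induction with
      | base => exact hs
      | succ k hk ih =>
        have h1 := hN (k + 1) (by omega)
        rcases hstep k with h2 | h2 <;> omega
    rw [tendsto_atTop]
    intro b
    have h3 : ∀ᶠ x in (atBot ⊔ atTop : Filter ℤ), b ≤ x ∨ x ≤ 0 :=
      eventually_sup.2 ⟨(eventually_le_atBot 0).mono fun _ => Or.inr,
        (eventually_ge_atTop b).mono fun _ => Or.inl⟩
    filter_upwards [h.eventually h3, eventually_ge_atTop N] with k hk hkN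
    rcases hk with hk | hk
    · exact hk
    · exact absurd (hpos k hkN) (by omega)

/-- Adding a bound `B` makes payments and values non-negative, so that the martingale arguments run
in `ℝ≥0∞` and need no integrability of the running cost. -/
lemma lintegral_ofReal_add_const {μ : Measure (ℕ → ℤ)} [IsProbabilityMeasure μ]
    {T : (ℕ → ℤ) → ℝ} (hT : Integrable T μ) {B : ℝ} (hB : ∀ X, 0 ≤ T X + B) :
    ∫⁻ X, ENNReal.ofReal (T X + B) ∂μ = ENNReal.ofReal (∫ X, T X ∂μ + B) := by
  have h := ofReal_integral_eq_lintegral_ofReal (f := fun X => T X + B)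
    (hT.add (integrable_const B)) (ae_of_all _ hB)
  rw [← h, integral_add hT (integrable_const B)]
  simp

lemma netMean_le_of_lintegral {μ : Measure (ℕ → ℤ)} [IsProbabilityMeasure μ]
    {T : (ℕ → ℤ) → ℝ} (hT : Integrable T μ) {S : Strategy} {B u : ℝ} (hB : ∀ X, 0 ≤ T X + B)
    (hu : 0 ≤ u + B) (h : ∫⁻ X, ENNReal.ofReal (T X + B) ∂μ ≤
      ENNReal.ofReal (u + B) + ∫⁻ X, S.cost X ∂μ) : netMean μ T S ≤ u := by
  rw [lintegral_ofReal_add_const hT hB] at h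
  unfold netMean
  by_cases hC : ∫⁻ X, S.cost X ∂μ = ⊤
  · rw [hC, EReal.coe_ennreal_top, EReal.sub_top]
    exact bot_le
  · rw [← ENNReal.ofReal_toReal hC] at h ⊢
    rw [← ENNReal.ofReal_add hu ENNReal.toReal_nonneg, ENNReal.ofReal_le_ofReal_iff
      (add_nonneg hu ENNReal.toReal_nonneg)] at h
    rw [EReal.coe_ennreal_ofReal, max_eq_left ENNReal.toReal_nonneg, ← EReal.coe_sub,
      EReal.coe_le_coe_iff]
    linarith

lemma le_netMean_of_lintegral {μ : Measure (ℕ → ℤ)} [IsProbabilityMeasure μ]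
    {T : (ℕ → ℤ) → ℝ} (hT : Integrable T μ) {S : Strategy} {B u : ℝ} (hB : ∀ X, 0 ≤ T X + B)
    (hu : 0 ≤ u + B) (h : ENNReal.ofReal (u + B) + ∫⁻ X, S.cost X ∂μ ≤
      ∫⁻ X, ENNReal.ofReal (T X + B) ∂μ) :
    u ≤ netMean μ T S := by
  rw [lintegral_ofReal_add_const hT hB] at h
  -- Here a finite mean cost is a conclusion: the shifted payment on the right has finite mean.
  have hC : ∫⁻ X, S.cost X ∂μ ≠ ⊤ := fun hC => by simp [hC] at h
  have h0 : 0 ≤ ∫ X, T X ∂μ + B := by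
    have := integral_nonneg (μ := μ) (f := fun X => T X + B) hB
    rw [integral_add hT (integrable_const B)] at this
    simpa using this
  unfold netMean
  rw [← ENNReal.ofReal_toReal hC] at h ⊢
  rw [← ENNReal.ofReal_add hu ENNReal.toReal_nonneg, ENNReal.ofReal_le_ofReal_iff h0] at h
  rw [EReal.coe_ennreal_ofReal, max_eq_left ENNReal.toReal_nonneg, ← EReal.coe_sub,
    EReal.coe_le_coe_iff]
  linarith

/-! ### Supermartingale and submartingale bounds, and verification. -/

namespace TrailGame

/-- The probability that turn `k + 1` is won by Maxine, given the counter's trajectory. -/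
noncomputable def turnProb (G : TrailGame) (Sm Sp : Strategy) (k : ℕ) (X : ℕ → ℤ) : ℝ :=
  G.rightProb (Sp.stake k (frestrictLe k X)) (Sm.stake k (frestrictLe k X))

variable (G : TrailGame) (Sm Sp : Strategy) (l : ℤ)

lemma turnProb_nonneg (k : ℕ) (X : ℕ → ℤ) : 0 ≤ G.turnProb Sm Sp k X := G.rightProb_nonneg _ _

lemma turnProb_le_one (k : ℕ) (X : ℕ → ℤ) : G.turnProb Sm Sp k X ≤ 1 := G.rightProb_le_one _ _

lemma lintegral_gameLaw_succ_site (k : ℕ) (U : ℤ → ℝ≥0∞) :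
    ∫⁻ X, U (X (k + 1)) ∂(G.gameLaw Sm Sp l) =
      ∫⁻ X, (ENNReal.ofReal (G.turnProb Sm Sp k X) * U (X k + 1) +
          ENNReal.ofReal (1 - G.turnProb Sm Sp k X) * U (X k - 1)) ∂(G.gameLaw Sm Sp l) :=
  G.lintegral_gameLaw_succ Sm Sp l k fun _ => U

lemma measurable_site (U : ℤ → ℝ≥0∞) (k : ℕ) : Measurable fun X : ℕ → ℤ => U (X k) :=
  (measurable_of_countable U).comp (measurable_pi_apply k)

lemma lintegral_gameLaw_zero (U : ℤ → ℝ≥0∞) :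
    ∫⁻ X, U (X 0) ∂(G.gameLaw Sm Sp l) = U l := by
  rw [lintegral_congr_ae (g := fun _ => U l)]
  · simp
  · filter_upwards [G.ae_gameLaw_zero Sm Sp l] with X hX
    rw [hX]

/-- Iterating the one-step identity: `U (X k)` minus the accumulated `c` is a supermartingale. The
costs are kept on the larger side to avoid subtraction in `ℝ≥0∞`. -/
lemma lintegral_site_le (U : ℤ → ℝ≥0∞) (c : ℕ → (ℕ → ℤ) → ℝ≥0∞)
    (h : ∀ᵐ X ∂(G.gameLaw Sm Sp l), ∀ k, ENNReal.ofReal (G.turnProb Sm Sp k X) * U (X k + 1) +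
      ENNReal.ofReal (1 - G.turnProb Sm Sp k X) * U (X k - 1) ≤ U (X k) + c k X) (k : ℕ) :
    ∫⁻ X, U (X k) ∂(G.gameLaw Sm Sp l) ≤
      U l + ∑ j ∈ Finset.range k, ∫⁻ X, c j X ∂(G.gameLaw Sm Sp l) := by
  induction k with
  | zero => simp [lintegral_gameLaw_zero]
  | succ k ih =>
    rw [lintegral_gameLaw_succ_site, Finset.sum_range_succ, ← add_assoc]
    calc _ ≤ ∫⁻ X, (U (X k) + c k X) ∂(G.gameLaw Sm Sp l) :=
          lintegral_mono_ae (h.mono fun X hX => hX k)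
      _ = ∫⁻ X, U (X k) ∂(G.gameLaw Sm Sp l) + ∫⁻ X, c k X ∂(G.gameLaw Sm Sp l) :=
          lintegral_add_left (measurable_site U k) _
      _ ≤ _ := by gcongr

lemma le_lintegral_site (U : ℤ → ℝ≥0∞) (c : ℕ → (ℕ → ℤ) → ℝ≥0∞)
    (h : ∀ᵐ X ∂(G.gameLaw Sm Sp l), ∀ k, U (X k) + c k X ≤
      ENNReal.ofReal (G.turnProb Sm Sp k X) * U (X k + 1) +
      ENNReal.ofReal (1 - G.turnProb Sm Sp k X) * U (X k - 1)) (k : ℕ) :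
    U l + ∑ j ∈ Finset.range k, ∫⁻ X, c j X ∂(G.gameLaw Sm Sp l) ≤
      ∫⁻ X, U (X k) ∂(G.gameLaw Sm Sp l) := by
  induction k with
  | zero => simp [lintegral_gameLaw_zero]
  | succ k ih =>
    rw [lintegral_gameLaw_succ_site, Finset.sum_range_succ, ← add_assoc]
    calc _ ≤ ∫⁻ X, U (X k) ∂(G.gameLaw Sm Sp l) + ∫⁻ X, c k X ∂(G.gameLaw Sm Sp l) := by gcongr
      _ = ∫⁻ X, (U (X k) + c k X) ∂(G.gameLaw Sm Sp l) :=
          (lintegral_add_left (measurable_site U k) _).symm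
      _ ≤ _ := lintegral_mono_ae (h.mono fun X hX => hX k)

lemma ofReal_average {p x y B : ℝ} (hp : 0 ≤ p) (hp1 : p ≤ 1) (hx : 0 ≤ x + B) (hy : 0 ≤ y + B) :
    ENNReal.ofReal p * ENNReal.ofReal (x + B) + ENNReal.ofReal (1 - p) * ENNReal.ofReal (y + B) =
      ENNReal.ofReal (p * x + (1 - p) * y + B) := by
  rw [← ENNReal.ofReal_mul hp, ← ENNReal.ofReal_mul (by linarith),
    ← ENNReal.ofReal_add (mul_nonneg hp hx) (mul_nonneg (by linarith) hy)]
  congr 1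
  ring

/-- The counter escapes when some bounded function of its location is a strict submartingale. -/
lemma ae_escape {w : ℤ → ℝ} {B : ℝ} (hw : ∀ i, |w i| ≤ B) {δ : ℤ → ℝ} (hδ : ∀ i, 0 < δ i)
    (h : ∀ᵐ X ∂(G.gameLaw Sm Sp l), ∀ k, w (X k) + δ (X k) ≤
      G.turnProb Sm Sp k X * w (X k + 1) + (1 - G.turnProb Sm Sp k X) * w (X k - 1)) :
    ∀ᵐ X ∂(G.gameLaw Sm Sp l), Tendsto X atTop atTop ∨ Tendsto X atTop atBot := by
  have hB : ∀ i, 0 ≤ w i + B := fun i => by linarith [neg_le_of_abs_le (hw i)]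
  have key := G.le_lintegral_site Sm Sp l (fun i => ENNReal.ofReal (w i + B))
    (fun k X => ENNReal.ofReal (δ (X k))) (by
      filter_upwards [h] with X hX k
      rw [ofReal_average (G.turnProb_nonneg Sm Sp k X) (G.turnProb_le_one Sm Sp k X) (hB _) (hB _),
        ← ENNReal.ofReal_add (hB _) (hδ _).le]
      exact ENNReal.ofReal_le_ofReal (by linarith [hX k]))
  -- The accumulated mean drift cannot exceed the oscillation of `w`, at most `2B`.
  have hbd : ∀ k, ∑ j ∈ Finset.range k, ∫⁻ X, ENNReal.ofReal (δ (X j)) ∂(G.gameLaw Sm Sp l) ≤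
      ENNReal.ofReal (B + B) := by
    intro k
    refine le_trans le_add_self ((key k).trans ?_)
    calc _ ≤ ∫⁻ _, ENNReal.ofReal (B + B) ∂(G.gameLaw Sm Sp l) :=
          lintegral_mono fun X => ENNReal.ofReal_le_ofReal
            (by linarith [le_of_abs_le (hw (X k))])
      _ = _ := by simp
  have hsum : ∫⁻ X, ∑' k, ENNReal.ofReal (δ (X k)) ∂(G.gameLaw Sm Sp l) ≠ ⊤ := by
    rw [lintegral_tsum fun k =>
      (measurable_site (fun i => ENNReal.ofReal (δ i)) k).aemeasurable]
    exact ne_top_of_le_ne_top ENNReal.ofReal_ne_top (ENNReal.tsum_le_of_sum_range_le hbd)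
  have hfin := ae_lt_top (Measurable.tsum fun k =>
    measurable_site (fun i => ENNReal.ofReal (δ i)) k) hsum
  filter_upwards [hfin, G.ae_gameLaw_step Sm Sp l] with X hX hs
  refine tendsto_atTop_or_atBot_of_cofinite hs ?_
  rw [← Nat.cofinite_eq_atTop]
  refine Tendsto.cofinite_of_finite_preimage_singleton fun i => ?_
  -- Each visit to `i` adds the same `δ i > 0` to a finite sum, so there are finitely many visits.
  have hf := ENNReal.finite_const_le_of_tsum_ne_top hX.ne
    (ε := ENNReal.ofReal (δ i)) (by simp [hδ i])
  refine hf.subset fun k hk => ?_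
  have hk' : X k = i := hk
  simp [hk']

/-- Verification from above: a supersolution bounds the mean net receipt. -/
lemma netMean_le (S : Strategy) {u : ℤ → ℝ} {r s t : ℝ} (hr : Tendsto u atTop (𝓝 r))
    (hs : Tendsto u atBot (𝓝 s)) (ht : ∀ i, t ≤ u i)
    (h : ∀ᵐ X ∂(G.gameLaw Sm Sp l), ∀ k,
      G.turnProb Sm Sp k X * u (X k + 1) + (1 - G.turnProb Sm Sp k X) * u (X k - 1) ≤
        u (X k) + S.stake k (frestrictLe k X)) :
    netMean (G.gameLaw Sm Sp l) (terminalPay r s t) S ≤ u l := by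
  obtain ⟨B₁, hB₁⟩ := exists_abs_le_of_tendsto hr hs
  obtain ⟨B₂, hB₂⟩ := exists_abs_terminalPay_le r s t
  set B := max B₁ B₂
  have hu : ∀ i, 0 ≤ u i + B := fun i => by
    linarith [neg_le_of_abs_le (hB₁ i), le_max_left B₁ B₂]
  have hT : ∀ X, 0 ≤ terminalPay r s t X + B := fun X => by
    linarith [neg_le_of_abs_le (hB₂ X), le_max_right B₁ B₂]
  refine netMean_le_of_lintegral (integrable_terminalPay _ _ _ _) hT (hu l) ?_
  have key := G.lintegral_site_le Sm Sp l (fun i => ENNReal.ofReal (u i + B))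
    (fun k X => S.stake k (frestrictLe k X)) (by
      filter_upwards [h] with X hX k
      rw [ofReal_average (G.turnProb_nonneg Sm Sp k X) (G.turnProb_le_one Sm Sp k X) (hu _) (hu _),
        ← ENNReal.ofReal_coe_nnreal, ← ENNReal.ofReal_add (hu _) (NNReal.coe_nonneg _)]
      exact ENNReal.ofReal_le_ofReal (by linarith [hX k]))
  -- Without escape `u (X k)` need not converge, but `t ≤ u` still bounds its lower limit. Fatou's
  -- lemma then applies to every deviation, escaping or not.
  have hlim : ∀ X : ℕ → ℤ, ENNReal.ofReal (terminalPay r s t X + B) ≤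
      liminf (fun k => ENNReal.ofReal (u (X k) + B)) atTop := by
    intro X
    unfold terminalPay
    split_ifs with h1 h2
    · exact (ENNReal.tendsto_ofReal ((hr.comp h1).add_const B)).liminf_eq.ge
    · exact (ENNReal.tendsto_ofReal ((hs.comp h2).add_const B)).liminf_eq.ge
    · exact le_liminf_of_le (by isBoundedDefault)
        (Eventually.of_forall fun k => ENNReal.ofReal_le_ofReal (by linarith [ht (X k)]))
  calc ∫⁻ X, ENNReal.ofReal (terminalPay r s t X + B) ∂(G.gameLaw Sm Sp l)
      ≤ ∫⁻ X, liminf (fun k => ENNReal.ofReal (u (X k) + B)) atTop ∂(G.gameLaw Sm Sp l) :=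
        lintegral_mono hlim
    _ ≤ liminf (fun k => ∫⁻ X, ENNReal.ofReal (u (X k) + B) ∂(G.gameLaw Sm Sp l)) atTop :=
        lintegral_liminf_le fun k => measurable_site (fun i => ENNReal.ofReal (u i + B)) k
    _ ≤ _ := by
        refine liminf_le_of_frequently_le' (Frequently.of_forall fun k => (key k).trans ?_)
        rw [Strategy.lintegral_cost]
        gcongr
        exact ENNReal.sum_le_tsum _

/-- Verification from below: a subsolution is attained, provided that the counter escapes. -/
lemma le_netMean (S : Strategy) {u : ℤ → ℝ} {r s r' s' t : ℝ}
    (hr : Tendsto u atTop (𝓝 r')) (hs : Tendsto u atBot (𝓝 s')) (hrr : r' ≤ r) (hss : s' ≤ s)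
    (hesc : ∀ᵐ X ∂(G.gameLaw Sm Sp l), Tendsto X atTop atTop ∨ Tendsto X atTop atBot)
    (h : ∀ᵐ X ∂(G.gameLaw Sm Sp l), ∀ k, u (X k) + S.stake k (frestrictLe k X) ≤
      G.turnProb Sm Sp k X * u (X k + 1) + (1 - G.turnProb Sm Sp k X) * u (X k - 1)) :
    u l ≤ netMean (G.gameLaw Sm Sp l) (terminalPay r s t) S := by
  obtain ⟨B₁, hB₁⟩ := exists_abs_le_of_tendsto hr hs
  obtain ⟨B₂, hB₂⟩ := exists_abs_terminalPay_le r s t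
  set B := max B₁ B₂
  have hu : ∀ i, 0 ≤ u i + B := fun i => by
    linarith [neg_le_of_abs_le (hB₁ i), le_max_left B₁ B₂]
  have hu2 : ∀ i, u i + B ≤ B + B := fun i => by
    linarith [le_of_abs_le (hB₁ i), le_max_left B₁ B₂]
  have hT : ∀ X, 0 ≤ terminalPay r s t X + B := fun X => by
    linarith [neg_le_of_abs_le (hB₂ X), le_max_right B₁ B₂]
  refine le_netMean_of_lintegral (integrable_terminalPay _ _ _ _) hT (hu l) ?_
  have key := G.le_lintegral_site Sm Sp l (fun i => ENNReal.ofReal (u i + B))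
    (fun k X => S.stake k (frestrictLe k X)) (by
      filter_upwards [h] with X hX k
      rw [ofReal_average (G.turnProb_nonneg Sm Sp k X) (G.turnProb_le_one Sm Sp k X) (hu _) (hu _),
        ← ENNReal.ofReal_coe_nnreal, ← ENNReal.ofReal_add (hu _) (NNReal.coe_nonneg _)]
      exact ENNReal.ofReal_le_ofReal (by linarith [hX k]))
  -- Almost sure escape lets dominated convergence replace Fatou's lemma. The limit carries the
  -- limits `r'`, `s'` of `u`, which are compared with the true payments at the end.
  have hlim : Tendsto (fun k => ∫⁻ X, ENNReal.ofReal (u (X k) + B) ∂(G.gameLaw Sm Sp l)) atTop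
      (𝓝 (∫⁻ X, ENNReal.ofReal (terminalPay r' s' t X + B) ∂(G.gameLaw Sm Sp l))) := by
    refine tendsto_lintegral_of_dominated_convergence (fun _ => ENNReal.ofReal (B + B))
      (fun k => measurable_site (fun i => ENNReal.ofReal (u i + B)) k)
      (fun k => ae_of_all _ fun X => ENNReal.ofReal_le_ofReal (hu2 _)) (by simp) ?_
    filter_upwards [hesc] with X hX
    rcases hX with hX | hX
    · rw [terminalPay_of_atTop _ _ _ hX]
      exact ENNReal.tendsto_ofReal ((hr.comp hX).add_const B)
    · rw [terminalPay_of_atBot _ _ _ hX]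
      exact ENNReal.tendsto_ofReal ((hs.comp hX).add_const B)
  have hsum : Tendsto (fun k => ENNReal.ofReal (u l + B) + ∑ j ∈ Finset.range k,
      ∫⁻ X, (S.stake j (frestrictLe j X) : ℝ≥0∞) ∂(G.gameLaw Sm Sp l)) atTop
      (𝓝 (ENNReal.ofReal (u l + B) + ∫⁻ X, S.cost X ∂(G.gameLaw Sm Sp l))) := by
    rw [Strategy.lintegral_cost]
    exact tendsto_const_nhds.add (ENNReal.tendsto_nat_tsum _)
  refine (le_of_tendsto_of_tendsto' hsum hlim key).trans (lintegral_mono_ae ?_)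
  filter_upwards [hesc] with X hX
  refine ENNReal.ofReal_le_ofReal ?_
  rcases hX with hX | hX
  · rw [terminalPay_of_atTop _ _ _ hX, terminalPay_of_atTop _ _ _ hX]
    linarith
  · rw [terminalPay_of_atBot _ _ _ hX, terminalPay_of_atBot _ _ _ hX]
    linarith

end TrailGame

/-! ### The Markov property at turn one. -/

/-- `μ` makes the counter a time-homogeneous Markov chain that moves right from `i` with probability
`q i`, and otherwise left. -/
def IsWalk (q : ℤ → ℝ) (μ : Measure (ℕ → ℤ)) : Prop :=
  ∀ (k : ℕ) (f : (Finset.Iic k → ℤ) → ℤ → ℝ≥0∞),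
    ∫⁻ X, f (frestrictLe k X) (X (k + 1)) ∂μ =
      ∫⁻ X, (ENNReal.ofReal (q (X k)) * f (frestrictLe k X) (X k + 1) +
        ENNReal.ofReal (1 - q (X k)) * f (frestrictLe k X) (X k - 1)) ∂μ

lemma measurable_frestrictLe_site {k : ℕ} (f : (Finset.Iic k → ℤ) → ℤ → ℝ≥0∞) (j : ℕ) :
    Measurable fun X : ℕ → ℤ => f (frestrictLe k X) (X j) := by
  have h : Measurable fun X : ℕ → ℤ => ((frestrictLe k X : Finset.Iic k → ℤ), X j) := by fun_prop
  exact (measurable_of_countable (Function.uncurry f)).comp h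

namespace IsWalk

variable {q : ℤ → ℝ} {μ ν : Measure (ℕ → ℤ)}

lemma add (hμ : IsWalk q μ) (hν : IsWalk q ν) : IsWalk q (μ + ν) := fun k f => by
  rw [lintegral_add_measure, lintegral_add_measure, hμ k f, hν k f]

lemma smul (hμ : IsWalk q μ) (c : ℝ≥0∞) : IsWalk q (c • μ) := fun k f => by
  rw [lintegral_smul_measure, lintegral_smul_measure, hμ k f]

/-- The law of a walk is determined by its transition probabilities and its initial law. -/
lemma ext [IsFiniteMeasure μ] [IsFiniteMeasure ν] (hμ : IsWalk q μ) (hν : IsWalk q ν)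
    (h0 : ∀ U : ℤ → ℝ≥0∞, ∫⁻ X, U (X 0) ∂μ = ∫⁻ X, U (X 0) ∂ν) : μ = ν := by
  have key : ∀ (k : ℕ) (f : (Finset.Iic k → ℤ) → ℝ≥0∞),
      ∫⁻ X, f (frestrictLe k X) ∂μ = ∫⁻ X, f (frestrictLe k X) ∂ν := by
    intro k
    induction k with
    | zero =>
      intro f
      have h := h0 fun x => f fun _ => x
      have hX : ∀ X : ℕ → ℤ, (fun _ => X 0 : Finset.Iic 0 → ℤ) = frestrictLe 0 X := by
        intro X
        ext ⟨i, hi⟩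
        obtain rfl : i = 0 := by simpa using hi
        rfl
      simpa only [hX] using h
    | succ k ih =>
      intro f
      -- A functional of `k + 1` steps is rewritten as one of `k` steps and the last location, so
      -- that the transition rule applies.
      let g : (Finset.Iic k → ℤ) → ℤ → ℝ≥0∞ := fun h y =>
        f fun i => if hi : (i : ℕ) ≤ k then h ⟨i, Finset.mem_Iic.2 hi⟩ else y
      have hg : ∀ X : ℕ → ℤ, f (frestrictLe (k + 1) X) = g (frestrictLe k X) (X (k + 1)) := by
        intro X
        simp only [g]
        congr 1
        ext ⟨i, hi⟩
        have hi' := Finset.mem_Iic.1 hi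
        by_cases hik : i ≤ k
        · simp [hik]
        · obtain rfl : i = k + 1 := by omega
          simp
      simp only [hg]
      rw [hμ k g, hν k g]
      exact ih fun h => ENNReal.ofReal (q (h (lastIndex k))) * g h (h (lastIndex k) + 1) +
        ENNReal.ofReal (1 - q (h (lastIndex k))) * g h (h (lastIndex k) - 1)
  have hmap : ∀ k : ℕ, μ.map (frestrictLe k) = ν.map (frestrictLe k) := by
    intro k
    refine Measure.ext fun s hs => ?_
    have h := key k (s.indicator 1)
    have h2 : Measurable (frestrictLe k : (ℕ → ℤ) → Finset.Iic k → ℤ) := by fun_prop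
    have h1 : Measurable (s.indicator (1 : (Finset.Iic k → ℤ) → ℝ≥0∞)) := measurable_of_countable _
    rw [← lintegral_map h1 h2, ← lintegral_map h1 h2,
      lintegral_indicator_one hs, lintegral_indicator_one hs] at h
    exact h
  -- Every finite set of times lies in an initial segment, so the laws of initial segments determine
  -- the measure.
  refine IsProjectiveLimit.unique (P := fun I : Finset ℕ => ν.map I.restrict) (fun I => ?_)
    fun I => rfl
  have hI : I ⊆ Finset.Iic (I.sup id) := I.subset_Iic_sup_id
  have hr : (I.restrict : (ℕ → ℤ) → I → ℤ) =
      Finset.restrict₂ (π := fun _ => ℤ) hI ∘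
        (frestrictLe (I.sup id) : (ℕ → ℤ) → Finset.Iic (I.sup id) → ℤ) := rfl
  rw [hr, ← Measure.map_map (by fun_prop) (by fun_prop), hmap,
    Measure.map_map (by fun_prop) (by fun_prop)]
  rfl

end IsWalk

/-- The trajectory from turn one onwards. -/
def shiftPath (X : ℕ → ℤ) : ℕ → ℤ := fun k => X (k + 1)

lemma measurable_shiftPath : Measurable shiftPath :=
  measurable_pi_lambda _ fun k => measurable_pi_apply (k + 1)

lemma terminalPay_shiftPath (r s t : ℝ) (X : ℕ → ℤ) :
    terminalPay r s t (shiftPath X) = terminalPay r s t X := by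
  have h1 : Tendsto (shiftPath X) atTop atTop ↔ Tendsto X atTop atTop :=
    tendsto_add_atTop_iff_nat (f := X) 1
  have h2 : Tendsto (shiftPath X) atTop atBot ↔ Tendsto X atTop atBot :=
    tendsto_add_atTop_iff_nat (f := X) 1
  unfold terminalPay
  split_ifs <;> tauto

namespace Strategy

/-- From turn two onwards, `S` stakes `s i` whenever the counter is at `i`. -/
def IsProfileAfter (S : Strategy) (s : ℤ → ℝ≥0) : Prop :=
  ∀ (k : ℕ) (ψ : TrailPath (k + 1)), S (k + 1) ψ = s ψ.terminal

lemma isProfileAfter_ofProfile (s : ℤ → ℝ≥0) : (ofProfile s).IsProfileAfter s := fun _ _ => rfl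

/-- The strategy that stakes `α` at the first turn and follows the profile `s` afterwards. -/
def deviateFirst (α : ℝ≥0) (s : ℤ → ℝ≥0) : Strategy := fun k ψ => if k = 0 then α else s ψ.terminal

lemma isProfileAfter_deviateFirst (α : ℝ≥0) (s : ℤ → ℝ≥0) :
    (deviateFirst α s).IsProfileAfter s := fun _ _ => rfl

lemma stake_zero_const (S : Strategy) {α : ℝ≥0} {l : ℤ}
    (h : ∀ ψ : TrailPath 0, ψ.terminal = l → S 0 ψ = α) : S.stake 0 (fun _ => l) = α := by
  have hv : ∀ i j : Finset.Iic 0, (j : ℕ) = (i : ℕ) + 1 → |l - l| = 1 := by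
    rintro ⟨i, hi⟩ ⟨j, hj⟩ hij
    simp only [Finset.mem_Iic] at hi hj
    simp only at hij
    omega
  rw [stake, dif_pos hv]
  exact h _ rfl

/-- After the first turn the stakes depend only on the current location, so forgetting the starting
point does not change them. -/
lemma cost_eq_add_shiftPath {S : Strategy} {s : ℤ → ℝ≥0} (hS : S.IsProfileAfter s) {X : ℕ → ℤ}
    (hX : ∀ k, |X (k + 1) - X k| = 1) :
    S.cost X = S.stake 0 (frestrictLe 0 X) + (ofProfile s).cost (shiftPath X) := by
  have h1 : S.cost X = ∑' k, (S.stake k (frestrictLe k X) : ℝ≥0∞) := rfl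
  have h2 : (ofProfile s).cost (shiftPath X) =
    ∑' k, ((ofProfile s).stake k (frestrictLe k (shiftPath X)) : ℝ≥0∞) := rfl
  rw [h1, h2, tsum_eq_zero_add' ENNReal.summable]
  congr 1
  refine tsum_congr fun k => ?_
  rw [stake_ofProfile s (X := shiftPath X) (fun j => hX (j + 1)), S.stake_of_forall s hX _ (hS k)]
  rfl

end Strategy

namespace TrailGame

variable (G : TrailGame)

lemma isWalk_gameLaw_ofProfile (a b : ℤ → ℝ≥0) (l : ℤ) :
    IsWalk (fun i => G.rightProb (a i) (b i))
      (G.gameLaw (Strategy.ofProfile b) (Strategy.ofProfile a) l) := fun k f => by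
  rw [lintegral_gameLaw_succ]
  refine lintegral_congr_ae ?_
  filter_upwards [G.ae_gameLaw_step (Strategy.ofProfile b) (Strategy.ofProfile a) l] with X hX
  simp only [Strategy.stake_ofProfile _ hX]

lemma isWalk_map_shiftPath {Sm Sp : Strategy} {a b : ℤ → ℝ≥0} (hm : Sm.IsProfileAfter b)
    (hp : Sp.IsProfileAfter a) (l : ℤ) :
    IsWalk (fun i => G.rightProb (a i) (b i)) ((G.gameLaw Sm Sp l).map shiftPath) := fun k f => by
  -- `e` drops time zero from a history, turning it into a history of the shifted path.
  let e : (Finset.Iic (k + 1) → ℤ) → (Finset.Iic k → ℤ) := fun h i =>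
    h ⟨i + 1, Finset.mem_Iic.2 (Nat.succ_le_succ (Finset.mem_Iic.1 i.2))⟩
  rw [lintegral_map (measurable_frestrictLe_site f (k + 1)) measurable_shiftPath,
    lintegral_map (measurable_frestrictLe_site (fun h x =>
      ENNReal.ofReal (G.rightProb (a x) (b x)) * f h (x + 1) +
        ENNReal.ofReal (1 - G.rightProb (a x) (b x)) * f h (x - 1)) k) measurable_shiftPath]
  have h := G.lintegral_gameLaw_succ Sm Sp l (k + 1) fun h y => f (e h) y
  refine Eq.trans h (lintegral_congr_ae ?_)
  filter_upwards [G.ae_gameLaw_step Sm Sp l] with X hX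
  rw [Sm.stake_of_forall b hX _ (hm k), Sp.stake_of_forall a hX _ (hp k)]
  rfl

/-- The Markov property at turn one. -/
lemma map_shiftPath_gameLaw {Sm Sp : Strategy} {a b : ℤ → ℝ≥0} (hm : Sm.IsProfileAfter b)
    (hp : Sp.IsProfileAfter a) {l : ℤ} {α β : ℝ≥0} (hα : Sp.stake 0 (fun _ => l) = α)
    (hβ : Sm.stake 0 (fun _ => l) = β) :
    (G.gameLaw Sm Sp l).map shiftPath =
      ENNReal.ofReal (G.rightProb α β) •
          G.gameLaw (Strategy.ofProfile b) (Strategy.ofProfile a) (l + 1) +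
        ENNReal.ofReal (1 - G.rightProb α β) •
          G.gameLaw (Strategy.ofProfile b) (Strategy.ofProfile a) (l - 1) := by
  have : IsFiniteMeasure (ENNReal.ofReal (G.rightProb α β) •
      G.gameLaw (Strategy.ofProfile b) (Strategy.ofProfile a) (l + 1)) :=
    Measure.smul_finite _ ENNReal.ofReal_ne_top
  have : IsFiniteMeasure (ENNReal.ofReal (1 - G.rightProb α β) •
      G.gameLaw (Strategy.ofProfile b) (Strategy.ofProfile a) (l - 1)) :=
    Measure.smul_finite _ ENNReal.ofReal_ne_top
  -- Both sides are walks with the same transition probabilities, so only the laws of the location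
  -- after the first turn remain to be compared.
  refine IsWalk.ext (G.isWalk_map_shiftPath hm hp l)
    (((G.isWalk_gameLaw_ofProfile a b _).smul _).add ((G.isWalk_gameLaw_ofProfile a b _).smul _))
    fun U => ?_
  rw [lintegral_map (measurable_site U 0) measurable_shiftPath, lintegral_add_measure,
    lintegral_smul_measure, lintegral_smul_measure, lintegral_gameLaw_zero, lintegral_gameLaw_zero]
  refine (G.lintegral_gameLaw_succ_site Sm Sp l 0 U).trans ?_
  rw [lintegral_congr_ae (g := fun _ => ENNReal.ofReal (G.rightProb α β) * U (l + 1) +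
    ENNReal.ofReal (1 - G.rightProb α β) * U (l - 1))]
  · simp
  · filter_upwards [G.ae_gameLaw_zero Sm Sp l] with X hX
    have hX0 : frestrictLe 0 X = (fun _ => l : Finset.Iic 0 → ℤ) := by
      ext ⟨i, hi⟩
      obtain rfl : i = 0 := by simpa using hi
      exact hX
    rw [turnProb, hX0, hα, hβ, hX]

lemma integral_terminalPay_first_step {Sm Sp : Strategy} {a b : ℤ → ℝ≥0}
    (hm : Sm.IsProfileAfter b) (hp : Sp.IsProfileAfter a) {l : ℤ} {α β : ℝ≥0}
    (hα : Sp.stake 0 (fun _ => l) = α) (hβ : Sm.stake 0 (fun _ => l) = β) (r s t : ℝ) :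
    ∫ X, terminalPay r s t X ∂(G.gameLaw Sm Sp l) =
      G.rightProb α β * ∫ X, terminalPay r s t X
          ∂(G.gameLaw (Strategy.ofProfile b) (Strategy.ofProfile a) (l + 1)) +
        (1 - G.rightProb α β) * ∫ X, terminalPay r s t X
          ∂(G.gameLaw (Strategy.ofProfile b) (Strategy.ofProfile a) (l - 1)) := by
  have h := G.map_shiftPath_gameLaw hm hp hα hβ
  have h1 : ∫ X, terminalPay r s t X ∂(G.gameLaw Sm Sp l) =
      ∫ X, terminalPay r s t X ∂((G.gameLaw Sm Sp l).map shiftPath) := by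
    rw [integral_map measurable_shiftPath.aemeasurable
      (measurable_terminalPay r s t).aestronglyMeasurable]
    simp only [terminalPay_shiftPath]
  rw [h1, h, integral_add_measure
    ((integrable_terminalPay _ _ _ _).smul_measure ENNReal.ofReal_ne_top)
    ((integrable_terminalPay _ _ _ _).smul_measure ENNReal.ofReal_ne_top), integral_smul_measure,
    integral_smul_measure, ENNReal.toReal_ofReal (G.rightProb_nonneg _ _),
    ENNReal.toReal_ofReal (sub_nonneg.2 (G.rightProb_le_one _ _))]
  rfl

lemma lintegral_cost_first_step {Sm Sp : Strategy} {a b : ℤ → ℝ≥0}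
    (hm : Sm.IsProfileAfter b) (hp : Sp.IsProfileAfter a) {l : ℤ} {α β : ℝ≥0}
    (hα : Sp.stake 0 (fun _ => l) = α) (hβ : Sm.stake 0 (fun _ => l) = β)
    {S : Strategy} {s : ℤ → ℝ≥0} (hS : S.IsProfileAfter s) :
    ∫⁻ X, S.cost X ∂(G.gameLaw Sm Sp l) = S.stake 0 (fun _ => l) +
      (ENNReal.ofReal (G.rightProb α β) * ∫⁻ X, (Strategy.ofProfile s).cost X
          ∂(G.gameLaw (Strategy.ofProfile b) (Strategy.ofProfile a) (l + 1)) +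
        ENNReal.ofReal (1 - G.rightProb α β) * ∫⁻ X, (Strategy.ofProfile s).cost X
          ∂(G.gameLaw (Strategy.ofProfile b) (Strategy.ofProfile a) (l - 1))) := by
  have h := G.map_shiftPath_gameLaw hm hp hα hβ
  have h1 : ∫⁻ X, S.cost X ∂(G.gameLaw Sm Sp l) =
      ∫⁻ X, (S.stake 0 (fun _ => l) + (Strategy.ofProfile s).cost (shiftPath X))
        ∂(G.gameLaw Sm Sp l) := by
    refine lintegral_congr_ae ?_
    filter_upwards [G.ae_gameLaw_zero Sm Sp l, G.ae_gameLaw_step Sm Sp l] with X hX hs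
    have hX0 : frestrictLe 0 X = (fun _ => l : Finset.Iic 0 → ℤ) := by
      ext ⟨i, hi⟩
      obtain rfl : i = 0 := by simpa using hi
      exact hX
    rw [Strategy.cost_eq_add_shiftPath hS hs, hX0]
  rw [h1, lintegral_add_left measurable_const, ← lintegral_map (Strategy.measurable_cost _)
    measurable_shiftPath, h, lintegral_add_measure, lintegral_smul_measure, lintegral_smul_measure]
  simp

/-- The mean net receipt of a player who follows `s` after the first turn, decomposed according to
the outcome of that turn. -/
lemma netMean_first_step {Sm Sp : Strategy} {a b : ℤ → ℝ≥0}
    (hm : Sm.IsProfileAfter b) (hp : Sp.IsProfileAfter a) {l : ℤ} {α β γ : ℝ≥0}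
    (hα : Sp.stake 0 (fun _ => l) = α) (hβ : Sm.stake 0 (fun _ => l) = β)
    {S : Strategy} {s : ℤ → ℝ≥0} (hS : S.IsProfileAfter s) (hγ : S.stake 0 (fun _ => l) = γ)
    {r s' t : ℝ} {v : ℤ → ℝ} (hv : ∀ i, (v i : EReal) = netMean
      (G.gameLaw (Strategy.ofProfile b) (Strategy.ofProfile a) i) (terminalPay r s' t)
      (Strategy.ofProfile s)) :
    netMean (G.gameLaw Sm Sp l) (terminalPay r s' t) S =
      ((G.rightProb α β * v (l + 1) + (1 - G.rightProb α β) * v (l - 1) - γ : ℝ) : EReal) := by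
  set μ := fun i => G.gameLaw (Strategy.ofProfile b) (Strategy.ofProfile a) i
  -- An infinite mean cost would make the net receipt `⊥`, which is not the real number `v i`.
  have hfin : ∀ i, ∫⁻ X, (Strategy.ofProfile s).cost X ∂(μ i) ≠ ⊤ := by
    intro i hi
    have h := hv i
    rw [netMean, hi, EReal.coe_ennreal_top, EReal.sub_top] at h
    exact EReal.coe_ne_bot _ h
  have hval : ∀ i, v i = ∫ X, terminalPay r s' t X ∂(μ i) -
      (∫⁻ X, (Strategy.ofProfile s).cost X ∂(μ i)).toReal := by
    intro i
    have h := hv i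
    rw [netMean, ← ENNReal.ofReal_toReal (hfin i), EReal.coe_ennreal_ofReal,
      max_eq_left ENNReal.toReal_nonneg, ← EReal.coe_sub, EReal.coe_eq_coe_iff] at h
    exact h
  have hp0 := G.rightProb_nonneg α β
  have hp1 := sub_nonneg.2 (G.rightProb_le_one α β)
  rw [netMean, G.integral_terminalPay_first_step hm hp hα hβ,
    G.lintegral_cost_first_step hm hp hα hβ hS, hγ]
  change ((_ * ∫ X, terminalPay r s' t X ∂(μ (l + 1)) +
    _ * ∫ X, terminalPay r s' t X ∂(μ (l - 1)) : ℝ) : EReal) - _ = _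
  rw [← ENNReal.ofReal_toReal (hfin (l + 1)), ← ENNReal.ofReal_toReal (hfin (l - 1)),
    ← ENNReal.ofReal_mul hp0, ← ENNReal.ofReal_mul hp1, ← ENNReal.ofReal_coe_nnreal,
    ← ENNReal.ofReal_add (by positivity) (by positivity),
    ← ENNReal.ofReal_add (by positivity) (by positivity), EReal.coe_ennreal_ofReal,
    max_eq_left (by positivity), ← EReal.coe_sub, EReal.coe_eq_coe_iff, hval, hval]
  ring

end TrailGame

/-! ### A potential for a player whose odds are better than even. -/

/-- A subsolution for a player who wins each turn with probability at least `p > 1/2` and whose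
stakes are at most a multiple of the increments of a strictly decreasing bounded function. -/
lemma exists_potential {β : ℤ → ℝ} (hβ : StrictAnti β) (h0 : Tendsto β atTop (𝓝 0)) {L : ℝ}
    (hL : Tendsto β atBot (𝓝 L)) {p : ℝ} (hp : 1 / 2 < p) (hp1 : p ≤ 1) (K s t : ℝ) :
    ∃ (u : ℤ → ℝ) (s' : ℝ), Tendsto u atTop (𝓝 t) ∧ s' ≤ s ∧ Tendsto u atBot (𝓝 s') ∧
      ∀ q, p ≤ q → q ≤ 1 → ∀ i,
        u i + K * (β i - β (i + 1)) ≤ q * u (i + 1) + (1 - q) * u (i - 1) := by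
  have hpos : ∀ i, 0 < β i := fun i =>
    (hβ.antitone.le_of_tendsto h0 (i + 1)).trans_lt (hβ (lt_add_one i))
  have hle : ∀ i, β i ≤ L := fun i => hβ.antitone.ge_of_tendsto hL i
  have hLpos : 0 < L := (hpos 0).trans_le (hle 0)
  -- `r` is the ratio of losing to winning probability. Below, `U` solves `U i - r * U (i - 1) = β
  -- i`, so the drift of `-U` under winning probability `p` is exactly `p * (β i - β (i + 1))`.
  obtain ⟨r, hr⟩ : ∃ r, r = (1 - p) / p := ⟨_, rfl⟩
  have hp0 : 0 < p := by linarith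
  have hr0 : 0 ≤ r := by rw [hr]; exact div_nonneg (by linarith) hp0.le
  have hr1 : r < 1 := by rw [hr, div_lt_one hp0]; linarith
  have hrp : p * r = 1 - p := by rw [hr]; field_simp
  have hgeom : Summable fun k : ℕ => r ^ k * L := (summable_geometric_of_lt_one hr0 hr1).mul_right L
  have hbound : ∀ (i : ℤ) (k : ℕ), ‖r ^ k * β (i - k)‖ ≤ r ^ k * L := fun i k => by
    rw [Real.norm_of_nonneg (mul_nonneg (pow_nonneg hr0 k) (hpos _).le)]
    exact mul_le_mul_of_nonneg_left (hle _) (pow_nonneg hr0 k)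
  have hsum : ∀ i : ℤ, Summable fun k : ℕ => r ^ k * β (i - k) := fun i =>
    Summable.of_norm_bounded hgeom (hbound i)
  let U : ℤ → ℝ := fun i => ∑' k : ℕ, r ^ k * β (i - k)
  have hrec : ∀ i, U i = β i + r * U (i - 1) := by
    intro i
    simp only [U]
    rw [(hsum i).tsum_eq_zero_add, ← tsum_mul_left]
    congr 1
    · simp
    · refine tsum_congr fun k => ?_
      rw [show i - ((k + 1 : ℕ) : ℤ) = i - 1 - k by push_cast; ring, pow_succ]
      ring
  have hanti : ∀ i, U (i + 1) ≤ U i := fun i =>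
    (hsum (i + 1)).tsum_le_tsum (fun k => mul_le_mul_of_nonneg_left
      (hβ.antitone (by omega)) (pow_nonneg hr0 k)) (hsum i)
  have htop : Tendsto U atTop (𝓝 0) := by
    have := tendsto_tsum_of_dominated_convergence (𝓕 := atTop) (f := fun i (k : ℕ) => r ^ k * β (i - k))
      (g := fun k => r ^ k * 0) hgeom (fun k => (h0.comp
        (tendsto_atTop_add_const_right atTop (-(k : ℤ)) tendsto_id)).const_mul _)
      (Eventually.of_forall hbound)
    simpa using this
  have hbot : Tendsto U atBot (𝓝 ((1 - r)⁻¹ * L)) := by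
    have := tendsto_tsum_of_dominated_convergence (𝓕 := atBot) (f := fun i (k : ℕ) => r ^ k * β (i - k))
      (g := fun k => r ^ k * L) hgeom (fun k => (hL.comp
        (tendsto_atBot_add_const_right atBot (-(k : ℤ)) tendsto_id)).const_mul _)
      (Eventually.of_forall hbound)
    rwa [tsum_mul_right, tsum_geometric_of_lt_one hr0 hr1] at this
  have hM : 0 < (1 - r)⁻¹ * L := mul_pos (inv_pos.2 (by linarith)) hLpos
  -- The potential will be `t - C * U`. The bound `K ≤ C * p` makes its drift cover the stakes, and
  -- the last bound brings its left limit down to at most `s`.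
  obtain ⟨C, hC0, hC1, hC2⟩ : ∃ C : ℝ, 0 ≤ C ∧ K ≤ C * p ∧ t - s ≤ C * ((1 - r)⁻¹ * L) := by
    refine ⟨max 0 (max (K / p) ((t - s) / ((1 - r)⁻¹ * L))), le_max_left _ _, ?_, ?_⟩
    · rw [← div_le_iff₀ hp0]
      exact (le_max_left _ _).trans (le_max_right _ _)
    · rw [← div_le_iff₀ hM]
      exact (le_max_right _ _).trans (le_max_right _ _)
  refine ⟨fun i => t - C * U i, t - C * ((1 - r)⁻¹ * L), ?_, by linarith, ?_, fun q hq hq1 i => ?_⟩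
  · simpa using (htop.const_mul C).const_sub t
  · exact (hbot.const_mul C).const_sub t
  · have h1 := hrec i
    have h2 := hrec (i + 1)
    rw [add_sub_cancel_right] at h2
    have h3 := hanti i
    have h4 := hanti (i - 1)
    rw [sub_add_cancel] at h4
    have h5 : 0 ≤ β i - β (i + 1) := sub_nonneg.2 (hβ (lt_add_one i)).le
    have h6 : K * (β i - β (i + 1)) ≤ C * p * (β i - β (i + 1)) :=
      mul_le_mul_of_nonneg_right hC1 h5
    -- The extra drift when the winning probability `q` exceeds `p`.
    have h7 : 0 ≤ C * ((q - p) * (U (i - 1) - U (i + 1))) :=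
      mul_nonneg hC0 (mul_nonneg (by linarith) (by linarith))
    have h8 : β i - β (i + 1) = U i - U (i + 1) - r * (U (i - 1) - U i) := by linarith
    have h9 : C * p * (β i - β (i + 1)) =
        C * (p * (U i - U (i + 1)) - (1 - p) * (U (i - 1) - U i)) := by
      rw [h8, ← hrp]
      ring
    nlinarith

/-! ### The one-turn contest and best replies. -/

/-- The tangent-line inequality for a power at most one. -/
lemma rpow_le_tangent {ρ x y : ℝ} (h0 : 0 ≤ ρ) (h1 : ρ ≤ 1) (hx : 0 ≤ x) (hy : 0 < y) :
    x ^ ρ ≤ y ^ ρ + ρ * y ^ (ρ - 1) * (x - y) := by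
  have h := rpow_one_add_le_one_add_mul_self (s := x / y - 1)
    (by linarith [div_nonneg hx hy.le]) h0 h1
  rw [add_sub_cancel, Real.div_rpow hx hy.le, div_le_iff₀ (Real.rpow_pos_of_pos hy ρ)] at h
  rw [Real.rpow_sub_one hy.ne']
  refine h.trans_eq ?_
  field_simp

lemma contestProb_eq_one_sub (ρ : ℝ) (a b : ℝ≥0) : contestProb ρ a b = 1 - contestProb ρ b a := by
  unfold contestProb
  by_cases h : a = 0 ∧ b = 0
  · rw [if_pos h, if_pos h.symm]
    norm_num
  · rw [if_neg h, if_neg fun h' => h h'.symm]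
    have : 0 < (b : ℝ) ^ ρ + (a : ℝ) ^ ρ := by
      rw [not_and_or] at h
      rcases h with h | h
      · have := Real.rpow_pos_of_pos (NNReal.coe_pos.2 (pos_iff_ne_zero.2 h)) ρ
        positivity
      · have := Real.rpow_pos_of_pos (NNReal.coe_pos.2 (pos_iff_ne_zero.2 h)) ρ
        positivity
    rw [add_comm ((a : ℝ) ^ ρ)]
    field_simp
    ring

lemma contestProb_of_pos (ρ : ℝ) (a : ℝ≥0) {b : ℝ≥0} (hb : 0 < b) :
    contestProb ρ a b = (a : ℝ) ^ ρ / ((b : ℝ) ^ ρ + (a : ℝ) ^ ρ) :=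
  if_neg fun h => hb.ne' h.2

lemma contestProb_zero_right {ρ : ℝ} (hρ : 0 < ρ) {a : ℝ≥0} (ha : 0 < a) :
    contestProb ρ a 0 = 1 := by
  have := Real.rpow_pos_of_pos (NNReal.coe_pos.2 ha) ρ
  rw [contestProb, if_neg fun h => ha.ne' h.1, NNReal.coe_zero, Real.zero_rpow hρ.ne', zero_add,
    div_self this.ne']

/-- The first-order condition identifies the unique optimal stake, because the contest function is
strictly concave. -/
lemma contestProb_mul_sub_lt {ρ κ D : ℝ} (h0 : 0 < ρ) (h1 : ρ ≤ 1) (hD : 0 < κ * D)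
    {a b γ : ℝ≥0} (ha : 0 < a) (hb : 0 < b)
    (h : ((a : ℝ) ^ ρ + (b : ℝ) ^ ρ) ^ 2 = ρ * κ * (a : ℝ) ^ (ρ - 1) * (b : ℝ) ^ ρ * D)
    (hγ : γ ≠ a) :
    κ * contestProb ρ γ b * D - γ < κ * contestProb ρ a b * D - a := by
  rw [contestProb_of_pos _ _ hb, contestProb_of_pos _ _ hb]
  have hA : 0 < (a : ℝ) ^ ρ := Real.rpow_pos_of_pos (NNReal.coe_pos.2 ha) ρ
  have hB : 0 < (b : ℝ) ^ ρ := Real.rpow_pos_of_pos (NNReal.coe_pos.2 hb) ρ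
  have hX : 0 ≤ (γ : ℝ) ^ ρ := by positivity
  have hT := rpow_le_tangent h0.le h1 γ.coe_nonneg (NNReal.coe_pos.2 ha)
  -- Strictness comes from the map sending `X` to `X / (B + X)` alone, since the tangent bound for
  -- the power is an equality when `ρ = 1`.
  have hne : (γ : ℝ) ^ ρ ≠ (a : ℝ) ^ ρ := fun he => hγ <| by
    rw [Real.rpow_left_inj γ.coe_nonneg a.coe_nonneg h0.ne'] at he
    exact NNReal.coe_injective he
  generalize (a : ℝ) ^ ρ = A at *
  generalize (b : ℝ) ^ ρ = B at *
  generalize (γ : ℝ) ^ ρ = X at *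
  generalize (a : ℝ) ^ (ρ - 1) = A' at *
  have hAB : 0 < B + A := by positivity
  have hXB : 0 < B + X := by positivity
  have hstrict : X / (B + X) < A / (B + A) + B / (B + A) ^ 2 * (X - A) := by
    have : A / (B + A) + B / (B + A) ^ 2 * (X - A) - X / (B + X) =
        B * (X - A) ^ 2 / ((B + X) * (B + A) ^ 2) := by
      field_simp
      ring
    have h2 : 0 < B * (X - A) ^ 2 / ((B + X) * (B + A) ^ 2) := by
      have := sub_ne_zero.2 hne
      positivity
    linarith
  have h3 : κ * D * (X / (B + X)) < κ * D * (A / (B + A) + B / (B + A) ^ 2 * (X - A)) :=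
    mul_lt_mul_of_pos_left hstrict hD
  have h4 : κ * D * (B / (B + A) ^ 2 * (X - A)) ≤
      κ * D * (B / (B + A) ^ 2 * (ρ * A' * ((γ : ℝ) - a))) := by
    refine mul_le_mul_of_nonneg_left (mul_le_mul_of_nonneg_left ?_ (by positivity)) hD.le
    linarith only [hT]
  -- The first-order condition says that the marginal gain at `a` equals the unit cost of staking.
  have h5 : κ * D * (B / (B + A) ^ 2 * (ρ * A' * ((γ : ℝ) - a))) = (γ : ℝ) - a := by
    have : (B + A) ^ 2 = ρ * κ * A' * B * D := by rw [← h]; ring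
    have h6 : κ * D * (B / (B + A) ^ 2 * (ρ * A' * ((γ : ℝ) - a))) =
      (ρ * κ * A' * B * D) / (B + A) ^ 2 * ((γ : ℝ) - a) := by ring
    rw [h6, ← this, div_self (by positivity), one_mul]
  linarith

lemma hasDerivAt_contest {ρ a B : ℝ} (ha : 0 < a) (hB : 0 < B) :
    HasDerivAt (fun x : ℝ => x ^ ρ / (B + x ^ ρ)) (ρ * a ^ (ρ - 1) * B / (B + a ^ ρ) ^ 2) a := by
  have hA : 0 < a ^ ρ := Real.rpow_pos_of_pos ha ρ
  have h := Real.hasDerivAt_rpow_const (p := ρ) (Or.inl ha.ne')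
  convert! h.div (h.const_add B) (by positivity) using 1
  field_simp
  ring

namespace TrailGame

variable (G : TrailGame)

lemma rightProb_eq_one_sub (a b : ℝ≥0) : G.rightProb a b = 1 - G.rightProb b a := by
  rw [rightProb, rightProb, contestProb_eq_one_sub]
  ring

lemma rightProb_zero_right {a : ℝ≥0} (ha : 0 < a) : G.rightProb a 0 = (1 + G.κ) / 2 := by
  rw [rightProb, contestProb_zero_right G.ρ_pos ha]
  ring

/-- At a site, the stake `α` is optimal against the stake `β` for a player whose value is `v` at the
site, `v₁` at the neighbour towards which this player pulls, and `v₀` at the other neighbour. -/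
structure IsBestReply (α β : ℝ≥0) (v v₁ v₀ : ℝ) : Prop where
  eq : G.rightProb α β * v₁ + (1 - G.rightProb α β) * v₀ - α = v
  le : ∀ γ : ℝ≥0, G.rightProb γ β * v₁ + (1 - G.rightProb γ β) * v₀ - γ ≤ v

namespace IsBestReply

variable {G} {α β : ℝ≥0} {v v₁ v₀ : ℝ}

/-- Against a zero stake every positive stake wins the contest for certain, so halving it keeps the
odds and costs less. -/
lemma eq_zero_of_zero (h : G.IsBestReply α 0 v v₁ v₀) : α = 0 := by
  by_contra hα
  have hα : 0 < α := pos_iff_ne_zero.2 hα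
  have h1 := h.le (α / 2)
  rw [← h.eq, rightProb_zero_right G hα, rightProb_zero_right G (half_pos hα)] at h1
  have : (0 : ℝ) < α := hα
  push_cast at h1
  linarith

/-- If `v₁` exceeded `v₀`, an arbitrarily small stake would raise the winning probability from `1 /
2` to `(1 + κ) / 2`. Otherwise `v` is the midpoint of the two. -/
lemma le_of_zero (h : G.IsBestReply 0 0 v v₁ v₀) : v₁ ≤ v ∧ v ≤ v₀ := by
  have h0 := h.eq
  have hr : G.rightProb 0 0 = 1 / 2 := by
    simp only [rightProb, contestProb, and_self, if_true]
    ring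
  rw [hr, NNReal.coe_zero] at h0
  have h1 : v₁ ≤ v₀ := by
    by_contra hc
    push Not at hc
    -- Half of the gain `κ * (v₁ - v₀) / 2` that such a stake brings.
    have hε : 0 < G.κ * (v₁ - v₀) / 4 :=
      div_pos (mul_pos G.κ_pos (sub_pos.2 hc)) (by norm_num)
    have h2 := h.le (G.κ * (v₁ - v₀) / 4).toNNReal
    rw [rightProb_zero_right G (Real.toNNReal_pos.2 hε), Real.coe_toNNReal _ hε.le] at h2
    nlinarith
  constructor <;> linarith

/-- The first-order condition at an interior optimum. -/
lemma first_order (h : G.IsBestReply α β v v₁ v₀) (hα : 0 < α) (hβ : 0 < β) :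
    ((α : ℝ) ^ G.ρ + (β : ℝ) ^ G.ρ) ^ 2 =
      G.ρ * G.κ * (α : ℝ) ^ (G.ρ - 1) * (β : ℝ) ^ G.ρ * (v₁ - v₀) := by
  have hA : 0 < (α : ℝ) ^ G.ρ := Real.rpow_pos_of_pos (NNReal.coe_pos.2 hα) _
  have hB : 0 < (β : ℝ) ^ G.ρ := Real.rpow_pos_of_pos (NNReal.coe_pos.2 hβ) _
  have hα' : (0 : ℝ) < α := hα
  let g : ℝ → ℝ := fun x => G.κ * (v₁ - v₀) * (x ^ G.ρ / ((β : ℝ) ^ G.ρ + x ^ G.ρ)) - x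
  have hd := ((hasDerivAt_contest (ρ := G.ρ) hα' hB).const_mul (G.κ * (v₁ - v₀))).sub
    (hasDerivAt_id (α : ℝ))
  have hmax : IsLocalMax g α := by
    filter_upwards [lt_mem_nhds hα'] with x hx
    have h1 := h.le x.toNNReal
    rw [← h.eq, rightProb, rightProb, contestProb_of_pos _ _ hβ, contestProb_of_pos _ _ hβ,
      Real.coe_toNNReal _ hx.le] at h1
    simp only [g]
    linarith
  have h0 := hmax.hasDerivAt_eq_zero hd
  have hne : ((β : ℝ) ^ G.ρ + (α : ℝ) ^ G.ρ) ^ 2 ≠ 0 := by positivity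
  have h1 : G.κ * (v₁ - v₀) * (G.ρ * (α : ℝ) ^ (G.ρ - 1) * (β : ℝ) ^ G.ρ /
      ((β : ℝ) ^ G.ρ + (α : ℝ) ^ G.ρ) ^ 2) = 1 := by linarith
  rw [mul_div_assoc', div_eq_one_iff_eq hne] at h1
  linarith

lemma lt_of_first_order (hα : 0 < α) (hβ : 0 < β)
    (h : ((α : ℝ) ^ G.ρ + (β : ℝ) ^ G.ρ) ^ 2 =
      G.ρ * G.κ * (α : ℝ) ^ (G.ρ - 1) * (β : ℝ) ^ G.ρ * (v₁ - v₀)) : v₀ < v₁ := by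
  have hA : 0 < (α : ℝ) ^ G.ρ := Real.rpow_pos_of_pos (NNReal.coe_pos.2 hα) _
  have hA' : 0 < (α : ℝ) ^ (G.ρ - 1) := Real.rpow_pos_of_pos (NNReal.coe_pos.2 hα) _
  have hB : 0 < (β : ℝ) ^ G.ρ := Real.rpow_pos_of_pos (NNReal.coe_pos.2 hβ) _
  have hκ := G.κ_pos
  have hρ := G.ρ_pos
  have h1 : 0 < G.ρ * G.κ * (α : ℝ) ^ (G.ρ - 1) * (β : ℝ) ^ G.ρ * (v₁ - v₀) := by
    rw [← h]; positivity
  exact sub_pos.1 (pos_of_mul_pos_right h1 (by positivity))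

lemma lt_of_ne (hρ : G.ρ ≤ 1) (hα : 0 < α) (hβ : 0 < β)
    (heq : G.rightProb α β * v₁ + (1 - G.rightProb α β) * v₀ - α = v)
    (h : ((α : ℝ) ^ G.ρ + (β : ℝ) ^ G.ρ) ^ 2 =
      G.ρ * G.κ * (α : ℝ) ^ (G.ρ - 1) * (β : ℝ) ^ G.ρ * (v₁ - v₀)) {γ : ℝ≥0} (hγ : γ ≠ α) :
    G.rightProb γ β * v₁ + (1 - G.rightProb γ β) * v₀ - γ < v := by
  have hD : 0 < v₁ - v₀ := sub_pos.2 (lt_of_first_order hα hβ h)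
  have h1 := contestProb_mul_sub_lt G.ρ_pos hρ (mul_pos G.κ_pos hD) hα hβ h hγ
  rw [← heq, rightProb, rightProb]
  linarith

/-- For exponents at most one, the first-order condition is sufficient. -/
lemma of_first_order (hρ : G.ρ ≤ 1) (hα : 0 < α) (hβ : 0 < β)
    (heq : G.rightProb α β * v₁ + (1 - G.rightProb α β) * v₀ - α = v)
    (h : ((α : ℝ) ^ G.ρ + (β : ℝ) ^ G.ρ) ^ 2 =
      G.ρ * G.κ * (α : ℝ) ^ (G.ρ - 1) * (β : ℝ) ^ G.ρ * (v₁ - v₀)) :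
    G.IsBestReply α β v v₁ v₀ := by
  refine ⟨heq, fun γ => ?_⟩
  rcases eq_or_ne γ α with rfl | hγ
  · exact heq.le
  · exact (lt_of_ne hρ hα hβ heq h hγ).le

/-- Staking zero yields at least `v₀` and is strictly worse than `α`; and `v + α` is an average of
`v₀ < v₁`. The second bound makes stakes summable, by telescoping the values. -/
lemma lt_and_add_le (h : G.IsBestReply α β v v₁ v₀) (hρ : G.ρ ≤ 1) (hα : 0 < α) (hβ : 0 < β) :
    v₀ < v ∧ v + α ≤ v₁ := by
  have hf := h.first_order hα hβ
  have hD := lt_of_first_order hα hβ hf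
  have hz := lt_of_ne hρ hα hβ h.eq hf hα.ne
  have h0 := G.rightProb_nonneg 0 β
  have h1 := G.rightProb_le_one α β
  have he := h.eq
  rw [NNReal.coe_zero] at hz
  constructor <;> nlinarith

end IsBestReply

/-- The probability with which a player wins a turn by staking twice the opponent's stake. -/
lemma exists_rightProb_double :
    ∃ p, 1 / 2 < p ∧ p ≤ 1 ∧ ∀ b : ℝ≥0, 0 < b → G.rightProb (2 * b) b = p := by
  have h2 : (1 : ℝ) < 2 ^ G.ρ := Real.one_lt_rpow (by norm_num) G.ρ_pos
  have hb : ∀ b : ℝ≥0, 0 < b → contestProb G.ρ (2 * b) b = 2 ^ G.ρ / (1 + 2 ^ G.ρ) := by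
    intro b hb
    have hB : 0 < (b : ℝ) ^ G.ρ := Real.rpow_pos_of_pos (NNReal.coe_pos.2 hb) _
    rw [contestProb_of_pos _ _ hb, NNReal.coe_mul, NNReal.coe_ofNat,
      Real.mul_rpow zero_le_two b.coe_nonneg]
    field_simp
  have hp : ∀ b : ℝ≥0, 0 < b → G.rightProb (2 * b) b =
      G.κ * (2 ^ G.ρ / (1 + 2 ^ G.ρ)) + (1 - G.κ) * (1 / 2) := fun b h => by rw [rightProb, hb b h]
  refine ⟨_, ?_, ?_, hp⟩
  · have : 1 / 2 < (2 : ℝ) ^ G.ρ / (1 + 2 ^ G.ρ) := by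
      rw [div_lt_div_iff₀ (by norm_num) (by positivity)]
      linarith
    nlinarith [G.κ_pos]
  · rw [← hp 1 one_pos]
    exact G.rightProb_le_one _ _

end TrailGame

/-! ### Values of profile pairs, and what a favoured player can secure. -/

section NetMean

variable {μ : Measure (ℕ → ℤ)} {T T' : (ℕ → ℤ) → ℝ} {S : Strategy}

lemma netMean_le_integral (μ : Measure (ℕ → ℤ)) (T : (ℕ → ℤ) → ℝ) (S : Strategy) :
    netMean μ T S ≤ ((∫ X, T X ∂μ : ℝ) : EReal) := by
  have h := EReal.sub_le_sub (le_refl ((∫ X, T X ∂μ : ℝ) : EReal))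
    (EReal.coe_ennreal_nonneg (∫⁻ X, S.cost X ∂μ))
  rwa [sub_zero] at h

lemma netMean_le_of_ae_le [IsProbabilityMeasure μ] (hT : Integrable T μ) {c : ℝ}
    (h : ∀ᵐ X ∂μ, T X ≤ c) : netMean μ T S ≤ c := by
  refine (netMean_le_integral μ T S).trans (EReal.coe_le_coe_iff.2 ?_)
  have := integral_mono_ae hT (integrable_const c) h
  simpa using this

lemma ae_eq_of_le_netMean [IsProbabilityMeasure μ] (hT : Integrable T μ) {c : ℝ}
    (hTc : ∀ X, T X ≤ c) (h : (c : EReal) ≤ netMean μ T S) : ∀ᵐ X ∂μ, T X = c := by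
  have h1 : c ≤ ∫ X, T X ∂μ := EReal.coe_le_coe_iff.1 (h.trans (netMean_le_integral μ T S))
  have hi : Integrable (fun X => c - T X) μ := (integrable_const c).sub hT
  have h2 : ∫ X, (c - T X) ∂μ = 0 := by
    refine le_antisymm ?_ (integral_nonneg fun X => sub_nonneg.2 (hTc X))
    rw [integral_sub (integrable_const c) hT]
    simpa using h1
  rw [integral_eq_zero_iff_of_nonneg (fun X => sub_nonneg.2 (hTc X)) hi] at h2
  filter_upwards [h2] with X hX
  exact (sub_eq_zero.1 hX).symm

/-- The running cost is the same in both, and finite because `v` is real, so it cancels. -/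
lemma integral_eq_of_netMean_eq {v : ℝ} (h : netMean μ T S = v) (h' : netMean μ T' S = v) :
    ∫ X, T X ∂μ = ∫ X, T' X ∂μ := by
  have hfin : ∫⁻ X, S.cost X ∂μ ≠ ⊤ := by
    intro hi
    rw [netMean, hi, EReal.coe_ennreal_top, EReal.sub_top] at h
    exact EReal.coe_ne_bot _ h.symm
  rw [netMean, ← ENNReal.ofReal_toReal hfin, EReal.coe_ennreal_ofReal,
    max_eq_left ENNReal.toReal_nonneg, ← EReal.coe_sub, EReal.coe_eq_coe_iff] at h h'
  linarith

lemma netMean_ofProfile_zero (μ : Measure (ℕ → ℤ)) (T : (ℕ → ℤ) → ℝ) :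
    netMean μ T (Strategy.ofProfile 0) = ((∫ X, T X ∂μ : ℝ) : EReal) := by
  have h : ∀ X, (Strategy.ofProfile 0).cost X = 0 := by
    intro X
    rw [Strategy.cost, ENNReal.tsum_eq_zero]
    intro k
    rw [Strategy.stake]
    split_ifs <;> rfl
  simp [netMean, h]

end NetMean

namespace TrailGame

variable (G : TrailGame)

/-- The law of the counter when the players stake according to profiles `a` and `b`. -/
noncomputable abbrev profileLaw (a b : ℤ → ℝ≥0) (l : ℤ) : Measure (ℕ → ℤ) :=
  G.gameLaw (Strategy.ofProfile b) (Strategy.ofProfile a) l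

lemma ae_profileLaw_turnProb (a b : ℤ → ℝ≥0) (l : ℤ) :
    ∀ᵐ X ∂(G.profileLaw a b l), ∀ k,
      G.turnProb (Strategy.ofProfile b) (Strategy.ofProfile a) k X =
        G.rightProb (a (X k)) (b (X k)) := by
  filter_upwards [G.ae_gameLaw_step (Strategy.ofProfile b) (Strategy.ofProfile a) l] with X hX k
  rw [turnProb, Strategy.stake_ofProfile _ hX, Strategy.stake_ofProfile _ hX]

variable {G} {a b : ℤ → ℝ≥0} {u : ℤ → ℝ} {r s : ℝ}

lemma ae_escape_profileLaw (hr : Tendsto u atTop (𝓝 r)) (hs : Tendsto u atBot (𝓝 s))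
    (h : ∀ i, u i < G.rightProb (a i) (b i) * u (i + 1) +
      (1 - G.rightProb (a i) (b i)) * u (i - 1)) (l : ℤ) :
    ∀ᵐ X ∂(G.profileLaw a b l), Tendsto X atTop atTop ∨ Tendsto X atTop atBot := by
  obtain ⟨B, hB⟩ := exists_abs_le_of_tendsto hr hs
  refine G.ae_escape _ _ l hB (δ := fun i => G.rightProb (a i) (b i) * u (i + 1) +
      (1 - G.rightProb (a i) (b i)) * u (i - 1) - u i) (fun i => sub_pos.2 (h i)) ?_
  filter_upwards [G.ae_profileLaw_turnProb a b l] with X hX k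
  rw [hX k]
  linarith

lemma le_netMean_profileLaw {r' s' : ℝ} (hr : Tendsto u atTop (𝓝 r)) (hs : Tendsto u atBot (𝓝 s))
    (hrr : r ≤ r') (hss : s ≤ s') (t : ℝ) {c : ℤ → ℝ≥0}
    (hesc : ∀ i, u i < G.rightProb (a i) (b i) * u (i + 1) +
      (1 - G.rightProb (a i) (b i)) * u (i - 1))
    (h : ∀ i, u i + c i ≤ G.rightProb (a i) (b i) * u (i + 1) +
      (1 - G.rightProb (a i) (b i)) * u (i - 1)) (l : ℤ) :
    u l ≤ netMean (G.profileLaw a b l) (terminalPay r' s' t) (Strategy.ofProfile c) := by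
  refine G.le_netMean _ _ l (Strategy.ofProfile c) hr hs hrr hss
    (ae_escape_profileLaw hr hs hesc l) ?_
  filter_upwards [G.ae_profileLaw_turnProb a b l,
    G.ae_gameLaw_step (Strategy.ofProfile b) (Strategy.ofProfile a) l] with X hX hs k
  rw [hX k, Strategy.stake_ofProfile _ hs]
  exact h _

/-- A bounded solution of the one-step equations, for a payoff function `u` and positive stakes `c`,
is the mean net receipt for terminal payments given by the limits of `u`. -/
lemma netMean_profileLaw_eq (hr : Tendsto u atTop (𝓝 r)) (hs : Tendsto u atBot (𝓝 s)) (t : ℝ)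
    {c : ℤ → ℝ≥0} (hc : ∀ i, 0 < c i)
    (h : ∀ i, G.rightProb (a i) (b i) * u (i + 1) +
      (1 - G.rightProb (a i) (b i)) * u (i - 1) - c i = u i) (l : ℤ) :
    netMean (G.profileLaw a b l) (terminalPay r s t) (Strategy.ofProfile c) = u l := by
  have hstrict : ∀ i, u i < G.rightProb (a i) (b i) * u (i + 1) +
      (1 - G.rightProb (a i) (b i)) * u (i - 1) := fun i => by
    have : (0 : ℝ) < c i := hc i
    linarith [h i]
  refine le_antisymm ?_ (le_netMean_profileLaw hr hs le_rfl le_rfl t hstrict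
    (fun i => by linarith [h i]) l)
  obtain ⟨B, hB⟩ := exists_abs_le_of_tendsto hr hs
  -- The upper bound needs an unfinished payment below all values, so `-B` stands in for `t`. Escape
  -- is almost sure, so the exchange does not change the mean.
  have key := G.netMean_le _ _ l (Strategy.ofProfile c) hr hs (t := -B)
    (fun i => neg_le_of_abs_le (hB i)) (by
      filter_upwards [G.ae_profileLaw_turnProb a b l,
        G.ae_gameLaw_step (Strategy.ofProfile b) (Strategy.ofProfile a) l] with X hX hs k
      rw [hX k, Strategy.stake_ofProfile _ hs]
      linarith [h (X k)])
  refine le_trans (le_of_eq ?_) key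
  rw [netMean, netMean, integral_congr_ae]
  filter_upwards [ae_escape_profileLaw hr hs hstrict l] with X hX
  rcases hX with hX | hX
  · rw [terminalPay_of_atTop _ _ _ hX, terminalPay_of_atTop _ _ _ hX]
  · rw [terminalPay_of_atBot _ _ _ hX, terminalPay_of_atBot _ _ _ hX]

/-- Maxine secures nearly the right-escape payment, starting far to the right, when she wins each turn
with probability at least `p > 1/2` at a summable cost. -/
lemma exists_le_netMean_right {β : ℤ → ℝ} (hβ : StrictAnti β) (h0 : Tendsto β atTop (𝓝 0)) {L : ℝ}
    (hL : Tendsto β atBot (𝓝 L)) {p : ℝ} (hp : 1 / 2 < p) {K : ℝ} (hK : 0 < K)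
    (hq : ∀ i, p ≤ G.rightProb (a i) (b i)) (ha : ∀ i, a i ≤ K * (β i - β (i + 1))) (r s t : ℝ) :
    ∃ u : ℤ → ℝ, Tendsto u atTop (𝓝 r) ∧ ∀ l,
      u l ≤ netMean (G.profileLaw a b l) (terminalPay r s t) (Strategy.ofProfile a) := by
  obtain ⟨u, s', hr, hss, hs, h⟩ := exists_potential hβ h0 hL hp
    ((hq 0).trans (G.rightProb_le_one _ _)) K s r
  refine ⟨u, hr, fun l => le_netMean_profileLaw hr hs le_rfl hss t (fun i => ?_) (fun i => ?_) l⟩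
  · have h1 := h _ (hq i) (G.rightProb_le_one _ _) i
    have h2 : 0 < K * (β i - β (i + 1)) := mul_pos hK (sub_pos.2 (hβ (lt_add_one i)))
    linarith
  · have h1 := h _ (hq i) (G.rightProb_le_one _ _) i
    linarith [ha i]

/-- The mirror image of `exists_le_netMean_right`, for Mina. -/
lemma exists_le_netMean_left {β : ℤ → ℝ} (hβ : StrictMono β) (h0 : Tendsto β atBot (𝓝 0)) {L : ℝ}
    (hL : Tendsto β atTop (𝓝 L)) {p : ℝ} (hp : 1 / 2 < p) {K : ℝ} (hK : 0 < K)
    (hq : ∀ i, p ≤ G.rightProb (b i) (a i)) (hb : ∀ i, b i ≤ K * (β i - β (i - 1))) (r s t : ℝ) :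
    ∃ u : ℤ → ℝ, Tendsto u atBot (𝓝 s) ∧ ∀ l,
      u l ≤ netMean (G.profileLaw a b l) (terminalPay r s t) (Strategy.ofProfile b) := by
  -- Reflecting the line by `i ↦ -i` turns Mina's wins into moves to the right.
  obtain ⟨u, r', hs, hrr, hr, h⟩ := exists_potential (β := fun i => β (-i))
    (fun i j hij => hβ (neg_lt_neg hij)) (h0.comp tendsto_neg_atTop_atBot)
    (hL.comp tendsto_neg_atBot_atTop) hp ((hq 0).trans (G.rightProb_le_one _ _)) K r s
  have h' : ∀ i, u (-i) + K * (β i - β (i - 1)) ≤ G.rightProb (a i) (b i) * u (-(i + 1)) +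
      (1 - G.rightProb (a i) (b i)) * u (-(i - 1)) := by
    intro i
    have h1 := h _ (hq i) (G.rightProb_le_one _ _) (-i)
    rw [G.rightProb_eq_one_sub (a i) (b i)]
    rw [neg_neg, show -(-i + 1) = i - 1 by ring, show -i + 1 = -(i - 1) by ring,
      show -i - 1 = -(i + 1) by ring] at h1
    linarith
  refine ⟨fun i => u (-i), hs.comp tendsto_neg_atBot_atTop, fun l =>
    le_netMean_profileLaw (u := fun i => u (-i)) (hr.comp tendsto_neg_atTop_atBot)
      (hs.comp tendsto_neg_atBot_atTop) hrr le_rfl t (fun i => ?_) (fun i => ?_) l⟩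
  · have h2 : 0 < K * (β i - β (i - 1)) := mul_pos hK (sub_pos.2 (hβ (sub_one_lt i)))
    linarith [h' i]
  · linarith [h' i, hb i]

end TrailGame

/-! ### Solutions of ABMN are equilibria. -/

namespace Quadruple

open TrailGame

/-- Clearing the denominator `2 * (a ^ ρ + b ^ ρ)`. The stake `c` is left free so that the
equivalence serves both players. -/
lemma step_eq_iff (G : TrailGame) {a b : ℝ≥0} (ha : 0 < a) (hb : 0 < b) (c v v₁ v₀ : ℝ) :
    2 * ((a : ℝ) ^ G.ρ + (b : ℝ) ^ G.ρ) * (v + c) =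
        ((a : ℝ) ^ G.ρ * (1 - G.κ) + (b : ℝ) ^ G.ρ * (1 + G.κ)) * v₀ +
          ((a : ℝ) ^ G.ρ * (1 + G.κ) + (b : ℝ) ^ G.ρ * (1 - G.κ)) * v₁ ↔
      G.rightProb a b * v₁ + (1 - G.rightProb a b) * v₀ - c = v := by
  have hA : 0 < (a : ℝ) ^ G.ρ := Real.rpow_pos_of_pos (NNReal.coe_pos.2 ha) _
  have hB : 0 < (b : ℝ) ^ G.ρ := Real.rpow_pos_of_pos (NNReal.coe_pos.2 hb) _
  rw [rightProb, contestProb_of_pos _ _ hb]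
  generalize (a : ℝ) ^ G.ρ = A at *
  generalize (b : ℝ) ^ G.ρ = B at *
  have h : (G.κ * (A / (B + A)) + (1 - G.κ) * (1 / 2)) * v₁ +
      (1 - (G.κ * (A / (B + A)) + (1 - G.κ) * (1 / 2))) * v₀ - c - v =
      ((A * (1 - G.κ) + B * (1 + G.κ)) * v₀ + (A * (1 + G.κ) + B * (1 - G.κ)) * v₁ -
        2 * (A + B) * (v + c)) / (2 * (A + B)) := by
    have : B + A ≠ 0 := by positivity
    have : A + B ≠ 0 := by positivity
    field_simp
    ring
  rw [← sub_eq_zero (b := v), h, div_eq_zero_iff]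
  constructor
  · intro h1
    left
    linarith
  · rintro (h1 | h1)
    · linarith
    · exact absurd h1 (by positivity)

variable {G : TrailGame} {q : Quadruple}

lemma IsABMN.isBestReply_m (h : q.IsABMN G.κ G.ρ) (hρ : G.ρ ≤ 1) (i : ℤ) :
    G.IsBestReply (q.a i) (q.b i) (q.m i) (q.m (i + 1)) (q.m (i - 1)) :=
  IsBestReply.of_first_order hρ (h.a_pos i) (h.b_pos i)
    ((step_eq_iff G (h.a_pos i) (h.b_pos i) _ _ _ _).1 (h.eq1 i)) (h.eq3 i)

lemma IsABMN.isBestReply_n (h : q.IsABMN G.κ G.ρ) (hρ : G.ρ ≤ 1) (i : ℤ) :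
    G.IsBestReply (q.b i) (q.a i) (q.n i) (q.n (i - 1)) (q.n (i + 1)) := by
  refine IsBestReply.of_first_order hρ (h.b_pos i) (h.a_pos i) ?_ ?_
  · rw [← (step_eq_iff G (h.a_pos i) (h.b_pos i) _ _ _ _).1 (h.eq2 i),
      G.rightProb_eq_one_sub (q.a i)]
    ring
  · rw [add_comm, h.eq4 i]
    ring

/-- A solution of the `ABMN` system with the boundary data of the game is a Nash equilibrium. -/
theorem IsABMN.isNash (hq : q.IsABMN G.κ G.ρ) (hb : q.HasBoundaryData G) (hρ : G.ρ ≤ 1) :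
    G.IsNash (Strategy.ofProfile q.b) (Strategy.ofProfile q.a) := by
  have hm := hq.isBestReply_m hρ
  have hn := hq.isBestReply_n hρ
  -- Monotonicity places every value above its boundary limit, hence above the payment for an
  -- unfinished game.
  have hmono : Monotone q.m := monotone_int_of_le_succ fun i => by
    have := ((hm i).lt_and_add_le hρ (hq.a_pos i) (hq.b_pos i)).2
    linarith [(q.a i).coe_nonneg]
  have hanti : Antitone q.n := antitone_int_of_succ_le fun i =>
    ((hn i).lt_and_add_le hρ (hq.b_pos i) (hq.a_pos i)).1.le
  intro S l
  rw [meanMaxine_eq, meanMaxine_eq, meanMina_eq, meanMina_eq,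
    netMean_profileLaw_eq hb.m_pos hb.m_neg _ hq.a_pos (fun i => (hm i).eq) l,
    netMean_profileLaw_eq hb.n_pos hb.n_neg _ hq.b_pos
      (fun i => by rw [← (hn i).eq, G.rightProb_eq_one_sub (q.a i)]; ring) l]
  constructor
  · refine G.netMean_le _ _ l S hb.m_pos hb.m_neg
      (fun i => G.mStar_lt.le.trans (hmono.le_of_tendsto hb.m_neg i)) ?_
    filter_upwards [G.ae_gameLaw_step (Strategy.ofProfile q.b) S l] with X hX k
    rw [turnProb, Strategy.stake_ofProfile _ hX]
    -- The deviator's stake may depend on the whole history, but the best-reply bound holds at the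
    -- current site for every stake.
    linarith [(hm (X k)).le (S.stake k (frestrictLe k X))]
  · refine G.netMean_le _ _ l S hb.n_pos hb.n_neg
      (fun i => G.nStar_lt.le.trans (hanti.le_of_tendsto hb.n_pos i)) ?_
    filter_upwards [G.ae_gameLaw_step S (Strategy.ofProfile q.a) l] with X hX k
    rw [turnProb, Strategy.stake_ofProfile _ hX, G.rightProb_eq_one_sub (q.a _)]
    linarith [(hn (X k)).le (S.stake k (frestrictLe k X))]

end Quadruple

/-! ### Equilibria solve ABMN with the boundary data of the game. -/

/-- The path of length zero at `i`. -/
def TrailPath.start (i : ℤ) : TrailPath 0 :=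
  ⟨fun _ => i, fun x y h => by
    have := Finset.mem_Iic.1 x.2
    have := Finset.mem_Iic.1 y.2
    omega⟩

/-- The stakes dictated at each site by a time-invariant strategy. -/
def Strategy.profile (S : Strategy) (i : ℤ) : ℝ≥0 := S 0 (TrailPath.start i)

lemma Strategy.IsTimeInvariant.ofProfile_profile {S : Strategy} (h : S.IsTimeInvariant) :
    Strategy.ofProfile S.profile = S := by
  funext k ψ
  exact h 0 k (TrailPath.start ψ.terminal) ψ rfl

lemma terminalPay_sub_left (r s s' t : ℝ) (X : ℕ → ℤ) :
    terminalPay r s t X - terminalPay r s' t X = (s - s') * terminalPay 0 1 0 X := by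
  unfold terminalPay
  split_ifs <;> ring

lemma terminalPay_sub_right (r r' s t : ℝ) (X : ℕ → ℤ) :
    terminalPay r s t X - terminalPay r' s t X = (r - r') * terminalPay 1 0 0 X := by
  unfold terminalPay
  split_ifs <;> ring

/-- Used with `e` the indicator of an escape event: two terminal payments that differ only there,
yet have equal means, show that the event is null. -/
lemma ae_eq_zero_of_integral_mul {μ : Measure (ℕ → ℤ)} [IsProbabilityMeasure μ] {r s t r' s' t' : ℝ}
    (h : ∫ X, terminalPay r s t X ∂μ = ∫ X, terminalPay r' s' t' X ∂μ) {c : ℝ} (hc : c ≠ 0)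
    {e : (ℕ → ℤ) → ℝ} (he : Integrable e μ) (he0 : ∀ X, 0 ≤ e X)
    (hsub : ∀ X, terminalPay r s t X - terminalPay r' s' t' X = c * e X) : ∀ᵐ X ∂μ, e X = 0 := by
  have h1 : ∫ X, (terminalPay r s t X - terminalPay r' s' t' X) ∂μ = 0 := by
    rw [integral_sub (integrable_terminalPay _ _ _ _) (integrable_terminalPay _ _ _ _), h, sub_self]
  simp only [hsub, integral_const_mul] at h1
  have h2 := (mul_eq_zero.1 h1).resolve_left hc
  exact (integral_eq_zero_iff_of_nonneg he0 he).1 h2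

namespace TrailGame

variable {G : TrailGame}

/-- The mean net receipts at an equilibrium of time-invariant strategies are finite. -/
lemma IsNash.exists_coe_eq {a b : ℤ → ℝ≥0}
    (h : G.IsNash (Strategy.ofProfile b) (Strategy.ofProfile a)) :
    ∃ m n : ℤ → ℝ,
      (∀ i, (m i : EReal) = G.meanMaxine (Strategy.ofProfile b) (Strategy.ofProfile a) i) ∧
      (∀ i, (n i : EReal) = G.meanMina (Strategy.ofProfile b) (Strategy.ofProfile a) i) := by
  have hm : ∀ i, ∃ v : ℝ,
      (v : EReal) = G.meanMaxine (Strategy.ofProfile b) (Strategy.ofProfile a) i := by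
    intro i
    -- Staking nothing has finite mean, so the equilibrium mean is not `⊥`.
    have h1 := (h (Strategy.ofProfile 0) i).1
    rw [meanMaxine_eq, meanMaxine_eq, netMean_ofProfile_zero] at h1
    have h2 := netMean_le_integral (G.profileLaw a b i)
      (terminalPay G.mPosInf G.mNegInf G.mStar) (Strategy.ofProfile a)
    exact ⟨_, EReal.coe_toReal (ne_top_of_le_ne_top (EReal.coe_ne_top _) h2)
      (ne_bot_of_le_ne_bot (EReal.coe_ne_bot _) h1)⟩
  have hn : ∀ i, ∃ v : ℝ,
      (v : EReal) = G.meanMina (Strategy.ofProfile b) (Strategy.ofProfile a) i := by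
    intro i
    have h1 := (h (Strategy.ofProfile 0) i).2
    rw [meanMina_eq, meanMina_eq, netMean_ofProfile_zero] at h1
    have h2 := netMean_le_integral (G.profileLaw a b i)
      (terminalPay G.nPosInf G.nNegInf G.nStar) (Strategy.ofProfile b)
    exact ⟨_, EReal.coe_toReal (ne_top_of_le_ne_top (EReal.coe_ne_top _) h2)
      (ne_bot_of_le_ne_bot (EReal.coe_ne_bot _) h1)⟩
  choose m hm using hm
  choose n hn using hn
  exact ⟨m, n, hm, hn⟩

end TrailGame

namespace Quadruple

open TrailGame Strategy

variable {G : TrailGame} {q : Quadruple}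

/-- `q` collects the stakes and the mean net receipts of an equilibrium of time-invariant
strategies. -/
structure IsEquilibrium (G : TrailGame) (q : Quadruple) : Prop where
  nash : G.IsNash (ofProfile q.b) (ofProfile q.a)
  m_eq : ∀ i, (q.m i : EReal) = G.meanMaxine (ofProfile q.b) (ofProfile q.a) i
  n_eq : ∀ i, (q.n i : EReal) = G.meanMina (ofProfile q.b) (ofProfile q.a) i

namespace IsEquilibrium

/-- A deviation confined to the first turn changes only the odds and the cost of that turn:
afterwards the Markov property returns the equilibrium values. -/
lemma isBestReply_m (h : q.IsEquilibrium G) (i : ℤ) :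
    G.IsBestReply (q.a i) (q.b i) (q.m i) (q.m (i + 1)) (q.m (i - 1)) := by
  have key : ∀ (S : Strategy) (γ : ℝ≥0), S.IsProfileAfter q.a → S.stake 0 (fun _ => i) = γ →
      G.meanMaxine (ofProfile q.b) S i = ((G.rightProb γ (q.b i) * q.m (i + 1) +
        (1 - G.rightProb γ (q.b i)) * q.m (i - 1) - γ : ℝ) : EReal) := fun S γ hS hγ =>
    G.netMean_first_step (isProfileAfter_ofProfile q.b) hS hγ
      (stake_zero_const _ fun ψ hψ => by rw [ofProfile, hψ]) hS hγ h.m_eq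
  refine ⟨?_, fun γ => ?_⟩
  · rw [← EReal.coe_eq_coe_iff, h.m_eq i, key _ _ (isProfileAfter_ofProfile q.a)
      (stake_zero_const _ fun ψ hψ => by rw [ofProfile, hψ])]
  · rw [← EReal.coe_le_coe_iff, h.m_eq i, ← key _ _ (isProfileAfter_deviateFirst γ q.a)
      (stake_zero_const _ fun _ _ => rfl)]
    exact (h.nash _ i).1

lemma isBestReply_n (h : q.IsEquilibrium G) (i : ℤ) :
    G.IsBestReply (q.b i) (q.a i) (q.n i) (q.n (i - 1)) (q.n (i + 1)) := by
  have key : ∀ (S : Strategy) (γ : ℝ≥0), S.IsProfileAfter q.b → S.stake 0 (fun _ => i) = γ →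
      G.meanMina S (ofProfile q.a) i = ((G.rightProb γ (q.a i) * q.n (i - 1) +
        (1 - G.rightProb γ (q.a i)) * q.n (i + 1) - γ : ℝ) : EReal) := fun S γ hS hγ => by
    refine (G.netMean_first_step hS (isProfileAfter_ofProfile q.a)
      (stake_zero_const _ fun ψ hψ => by rw [ofProfile, hψ]) hγ hS hγ h.n_eq).trans ?_
    rw [G.rightProb_eq_one_sub (q.a i), EReal.coe_eq_coe_iff]
    ring
  refine ⟨?_, fun γ => ?_⟩
  · rw [← EReal.coe_eq_coe_iff, h.n_eq i, key _ _ (isProfileAfter_ofProfile q.b)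
      (stake_zero_const _ fun ψ hψ => by rw [ofProfile, hψ])]
  · rw [← EReal.coe_le_coe_iff, h.n_eq i, ← key _ _ (isProfileAfter_deviateFirst γ q.b)
      (stake_zero_const _ fun _ _ => rfl)]
    exact (h.nash _ i).2

lemma m_le (h : q.IsEquilibrium G) (i : ℤ) : q.m i ≤ G.mPosInf := by
  rw [← EReal.coe_le_coe_iff, h.m_eq i]
  refine netMean_le_of_ae_le (integrable_terminalPay _ _ _ _) (ae_of_all _ ?_)
  exact terminalPay_mem (A := Set.Iic _) _ _ _ (by simp) G.m_lt.le (G.mStar_lt.trans G.m_lt).le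

lemma n_le (h : q.IsEquilibrium G) (i : ℤ) : q.n i ≤ G.nNegInf := by
  rw [← EReal.coe_le_coe_iff, h.n_eq i]
  refine netMean_le_of_ae_le (integrable_terminalPay _ _ _ _) (ae_of_all _ ?_)
  exact terminalPay_mem (A := Set.Iic _) _ _ _ G.n_lt.le (by simp) (G.nStar_lt.trans G.n_lt).le

lemma le_m (h : q.IsEquilibrium G) (i : ℤ) : G.mStar ≤ q.m i := by
  rw [← EReal.coe_le_coe_iff, h.m_eq i]
  refine le_trans ?_ (h.nash (ofProfile 0) i).1
  rw [meanMaxine_eq, netMean_ofProfile_zero, EReal.coe_le_coe_iff]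
  have := integral_mono (μ := G.gameLaw (ofProfile q.b) (ofProfile 0) i)
    (integrable_const G.mStar) (integrable_terminalPay G.mPosInf G.mNegInf G.mStar _)
    (terminalPay_mem (A := Set.Ici _) _ _ _ (G.mStar_lt.trans G.m_lt).le G.mStar_lt.le (by simp))
  simpa using this

lemma le_n (h : q.IsEquilibrium G) (i : ℤ) : G.nStar ≤ q.n i := by
  rw [← EReal.coe_le_coe_iff, h.n_eq i]
  refine le_trans ?_ (h.nash (ofProfile 0) i).2
  rw [meanMina_eq, netMean_ofProfile_zero, EReal.coe_le_coe_iff]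
  have := integral_mono (μ := G.gameLaw (ofProfile 0) (ofProfile q.a) i)
    (integrable_const G.nStar) (integrable_terminalPay G.nPosInf G.nNegInf G.nStar _)
    (terminalPay_mem (A := Set.Ici _) _ _ _ G.nStar_lt.le (G.nStar_lt.trans G.n_lt).le (by simp))
  simpa using this

lemma a_eq_zero_iff (h : q.IsEquilibrium G) (i : ℤ) : q.a i = 0 ↔ q.b i = 0 := by
  constructor
  · intro ha
    have := h.isBestReply_n i
    rw [ha] at this
    exact this.eq_zero_of_zero
  · intro hb
    have := h.isBestReply_m i
    rw [hb] at this
    exact this.eq_zero_of_zero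

/-- Not all stakes vanish at an equilibrium: otherwise each player could force victory at a
negligible cost. -/
lemma exists_b_ne_zero (h : q.IsEquilibrium G) : ∃ i, q.b i ≠ 0 := by
  by_contra hc
  push Not at hc
  have hca : ∀ i, q.a i = 0 := fun i => (h.a_eq_zero_iff i).2 (hc i)
  have hm : ∀ i, q.m (i + 1) ≤ q.m i := fun i => by
    have := h.isBestReply_m i
    rw [hc, hca] at this
    exact this.le_of_zero.1
  have hn : ∀ i, q.n i ≤ q.n (i + 1) := fun i => by
    have := h.isBestReply_n i
    rw [hc, hca] at this
    exact this.le_of_zero.2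
  have hm := antitone_int_of_succ_le hm
  have hn := monotone_int_of_le_succ hn
  have hκ : 1 / 2 < (1 + G.κ) / 2 := by linarith [G.κ_pos]
  -- Any bounded strictly monotone function would do; its increments serve as positive summable
  -- stakes.
  have harc : StrictMono fun i : ℤ => Real.arctan i := fun i j hij =>
    Real.arctan_strictMono (Int.cast_lt.2 hij)
  have htop : Tendsto (fun i : ℤ => Real.arctan i) atTop (𝓝 (Real.pi / 2)) :=
    (Real.tendsto_arctan_atTop.mono_right nhdsWithin_le_nhds).comp tendsto_intCast_atTop_atTop
  have hbot : Tendsto (fun i : ℤ => Real.arctan i) atBot (𝓝 (-(Real.pi / 2))) :=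
    (Real.tendsto_arctan_atBot.mono_right nhdsWithin_le_nhds).comp (tendsto_intCast_atBot_iff.2 tendsto_id)
  have h1 : ∀ i, q.m i = G.mPosInf := by
    have hpos : ∀ i : ℤ, 0 < (Real.pi / 2 - Real.arctan i) - (Real.pi / 2 - Real.arctan (i + 1 : ℤ)) :=
      fun i => by linarith [harc (lt_add_one i)]
    obtain ⟨u, hu, hle⟩ := exists_le_netMean_right (G := G) (b := q.b)
      (a := fun i : ℤ => Real.toNNReal
        ((Real.pi / 2 - Real.arctan i) - (Real.pi / 2 - Real.arctan (i + 1 : ℤ))))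
      (β := fun i : ℤ => Real.pi / 2 - Real.arctan i) (fun i j hij => sub_lt_sub_left (harc hij) _)
      (by simpa using htop.const_sub (Real.pi / 2)) (hbot.const_sub (Real.pi / 2)) hκ one_pos
      (fun i => by rw [hc, G.rightProb_zero_right (Real.toNNReal_pos.2 (hpos i))])
      (fun i => by rw [Real.coe_toNNReal _ (hpos i).le, one_mul]) G.mPosInf G.mNegInf G.mStar
    intro i
    refine le_antisymm (h.m_le i) (le_of_tendsto hu ?_)
    -- Far to the right the deviation secures nearly `mPosInf`, and with all stakes zero `q.m` is
    -- antitone, so the bound carries back to `i`.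
    filter_upwards [eventually_ge_atTop i] with j hj
    refine le_trans (EReal.coe_le_coe_iff.1 ?_) (hm hj)
    rw [h.m_eq]
    exact (hle j).trans (h.nash _ j).1
  have h2 : ∀ i, q.n i = G.nNegInf := by
    have hpos : ∀ i : ℤ, 0 < (Real.arctan i + Real.pi / 2) - (Real.arctan (i - 1 : ℤ) + Real.pi / 2) :=
      fun i => by linarith [harc (sub_one_lt i)]
    obtain ⟨u, hu, hle⟩ := exists_le_netMean_left (G := G) (a := q.a)
      (b := fun i : ℤ => Real.toNNReal
        ((Real.arctan i + Real.pi / 2) - (Real.arctan (i - 1 : ℤ) + Real.pi / 2)))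
      (β := fun i : ℤ => Real.arctan i + Real.pi / 2) (fun i j hij => add_lt_add_left (harc hij) _)
      (by simpa using hbot.add_const (Real.pi / 2)) (htop.add_const (Real.pi / 2)) hκ one_pos
      (fun i => by rw [hca, G.rightProb_zero_right (Real.toNNReal_pos.2 (hpos i))])
      (fun i => by rw [Real.coe_toNNReal _ (hpos i).le, one_mul]) G.nPosInf G.nNegInf G.nStar
    intro i
    refine le_antisymm (h.n_le i) (le_of_tendsto hu ?_)
    filter_upwards [eventually_le_atBot i] with j hj
    refine le_trans (EReal.coe_le_coe_iff.1 ?_) (hn hj)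
    rw [h.n_eq]
    exact (hle j).trans (h.nash _ j).2
  have e1 := ae_eq_of_le_netMean (integrable_terminalPay G.mPosInf G.mNegInf G.mStar
    (G.profileLaw q.a q.b 0)) (terminalPay_mem (A := Set.Iic G.mPosInf) _ _ _ (by simp) G.m_lt.le
      (G.mStar_lt.trans G.m_lt).le) ((EReal.coe_eq_coe_iff.2 (h1 0)).symm.trans (h.m_eq 0)).le
  have e2 := ae_eq_of_le_netMean (integrable_terminalPay G.nPosInf G.nNegInf G.nStar
    (G.profileLaw q.a q.b 0)) (terminalPay_mem (A := Set.Iic G.nNegInf) _ _ _ G.n_lt.le (by simp)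
      (G.nStar_lt.trans G.n_lt).le) ((EReal.coe_eq_coe_iff.2 (h2 0)).symm.trans (h.n_eq 0)).le
  -- On one trajectory both players would receive their highest payment, but these belong to
  -- opposite escapes.
  obtain ⟨X, hX1, hX2⟩ := (e1.and e2).exists
  have := G.m_lt
  have := G.n_lt
  have := G.mStar_lt
  have := G.nStar_lt
  unfold terminalPay at hX1 hX2
  split_ifs at hX1 hX2 <;> linarith

/-- All stakes are positive at an equilibrium. -/
lemma pos (h : q.IsEquilibrium G) (hρ : G.ρ ≤ 1) : ∀ i, 0 < q.a i ∧ 0 < q.b i := by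
  obtain ⟨i₀, hi₀⟩ := h.exists_b_ne_zero
  have hmono : ∀ i, q.b i ≠ 0 → q.m (i - 1) < q.m i ∧ q.m i < q.m (i + 1) := fun i hi => by
    have ha : 0 < q.a i := pos_iff_ne_zero.2 fun ha => hi ((h.a_eq_zero_iff i).1 ha)
    have h1 := (h.isBestReply_m i).lt_and_add_le hρ ha (pos_iff_ne_zero.2 hi)
    have h2 : (0 : ℝ) < q.a i := ha
    exact ⟨h1.1, by linarith⟩
  have hzero : ∀ i, q.b i = 0 → q.m (i + 1) ≤ q.m i ∧ q.m i ≤ q.m (i - 1) := fun i hi => by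
    have h1 := h.isBestReply_m i
    rw [hi, (h.a_eq_zero_iff i).2 hi] at h1
    exact h1.le_of_zero
  have hb : ∀ i, q.b i ≠ 0 := by
    intro i
    -- Neighbours of different type disagree about the increment of `q.m` between them: strictly
    -- positive from one site, non-positive from the other.
    induction i using Int.inductionOn' (b := i₀) with
    | zero => exact hi₀
    | succ k _ ih =>
      intro hz
      have h1 := (hmono k ih).2
      have h2 := (hzero _ hz).2
      rw [add_sub_cancel_right] at h2
      linarith
    | pred k _ ih =>
      intro hz
      have h1 := (hmono k ih).1
      have h2 := (hzero _ hz).1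
      rw [sub_add_cancel] at h2
      linarith
  exact fun i => ⟨pos_iff_ne_zero.2 fun ha => hb i ((h.a_eq_zero_iff i).1 ha),
    pos_iff_ne_zero.2 (hb i)⟩

lemma isABMN (h : q.IsEquilibrium G) (hρ : G.ρ ≤ 1) : q.IsABMN G.κ G.ρ where
  a_pos i := (h.pos hρ i).1
  b_pos i := (h.pos hρ i).2
  eq1 i := (step_eq_iff G (h.pos hρ i).1 (h.pos hρ i).2 _ _ _ _).2 (h.isBestReply_m i).eq
  eq2 i := (step_eq_iff G (h.pos hρ i).1 (h.pos hρ i).2 _ _ _ _).2 (by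
    rw [← (h.isBestReply_n i).eq, G.rightProb_eq_one_sub (q.a i)]
    ring)
  eq3 i := (h.isBestReply_m i).first_order (h.pos hρ i).1 (h.pos hρ i).2
  eq4 i := by
    rw [add_comm, (h.isBestReply_n i).first_order (h.pos hρ i).2 (h.pos hρ i).1]
    ring

/-- The limits exist by monotonicity. Those on each player's winning side follow from what doubling
the opponent's stakes secures; the other two compare the actual terminal payment with the limit of
the values. -/
lemma hasBoundaryData (h : q.IsEquilibrium G) (hρ : G.ρ ≤ 1) : q.HasBoundaryData G := by
  have hm := fun i => (h.isBestReply_m i).lt_and_add_le hρ (h.pos hρ i).1 (h.pos hρ i).2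
  have hn := fun i => (h.isBestReply_n i).lt_and_add_le hρ (h.pos hρ i).2 (h.pos hρ i).1
  have hmono : StrictMono q.m := strictMono_int_of_lt_succ fun i => by
    have := (hm (i + 1)).1
    rwa [add_sub_cancel_right] at this
  have hanti : StrictAnti q.n := strictAnti_int_of_succ_lt fun i => (hn i).1
  obtain ⟨Mp, hMp⟩ : ∃ x, Tendsto q.m atTop (𝓝 x) :=
    ⟨_, tendsto_atTop_ciSup hmono.monotone ⟨_, Set.forall_mem_range.2 h.m_le⟩⟩
  obtain ⟨Mm, hMm⟩ : ∃ x, Tendsto q.m atBot (𝓝 x) :=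
    ⟨_, tendsto_atBot_ciInf hmono.monotone ⟨_, Set.forall_mem_range.2 h.le_m⟩⟩
  obtain ⟨Nm, hNm⟩ : ∃ x, Tendsto q.n atBot (𝓝 x) :=
    ⟨_, tendsto_atBot_ciSup hanti.antitone ⟨_, Set.forall_mem_range.2 h.n_le⟩⟩
  obtain ⟨Np, hNp⟩ : ∃ x, Tendsto q.n atTop (𝓝 x) :=
    ⟨_, tendsto_atTop_ciInf hanti.antitone ⟨_, Set.forall_mem_range.2 h.le_n⟩⟩
  obtain ⟨p, hp, -, hdouble⟩ := G.exists_rightProb_double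
  have hMp' : Mp = G.mPosInf := by
    -- Since `q.b i ≤ q.n (i - 1) - q.n i`, the doubled stakes are at most twice the increments of
    -- the shifted values of Mina, whence `K = 2`.
    obtain ⟨u, hu, hle⟩ := exists_le_netMean_right (G := G) (b := q.b) (a := fun i => 2 * q.b i)
      (β := fun i => q.n (i - 1) - Np) (fun i j hij => sub_lt_sub_right (hanti (by omega)) _)
      (by simpa [Function.comp_def, ← sub_eq_add_neg] using (hNp.comp (tendsto_atTop_add_const_right atTop (-1) tendsto_id)).sub_const Np)
      ((hNm.comp (tendsto_atBot_add_const_right atBot (-1) tendsto_id)).sub_const Np)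
      hp two_pos (fun i => (hdouble _ (h.pos hρ i).2).ge)
      (fun i => by
        have := (hn i).2
        rw [add_sub_cancel_right, NNReal.coe_mul, NNReal.coe_ofNat]
        linarith) G.mPosInf G.mNegInf G.mStar
    refine le_antisymm (le_of_tendsto' hMp h.m_le) (le_of_tendsto_of_tendsto' hu hMp fun j => ?_)
    rw [← EReal.coe_le_coe_iff, h.m_eq]
    exact (hle j).trans (h.nash _ j).1
  have hNm' : Nm = G.nNegInf := by
    obtain ⟨u, hu, hle⟩ := exists_le_netMean_left (G := G) (a := q.a) (b := fun i => 2 * q.a i)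
      (β := fun i => q.m (i + 1) - Mm) (fun i j hij => sub_lt_sub_right (hmono (by omega)) _)
      (by simpa using (hMm.comp (tendsto_atBot_add_const_right atBot 1 tendsto_id)).sub_const Mm)
      ((hMp.comp (tendsto_atTop_add_const_right atTop 1 tendsto_id)).sub_const Mm)
      hp two_pos (fun i => (hdouble _ (h.pos hρ i).1).ge)
      (fun i => by
        have := (hm i).2
        rw [sub_add_cancel, NNReal.coe_mul, NNReal.coe_ofNat]
        linarith) G.nPosInf G.nNegInf G.nStar
    refine le_antisymm (le_of_tendsto' hNm h.n_le) (le_of_tendsto_of_tendsto' hu hNm fun j => ?_)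
    rw [← EReal.coe_le_coe_iff, h.n_eq]
    exact (hle j).trans (h.nash _ j).2
  subst hMp' hNm'
  have hMm' : Mm = G.mNegInf := by
    by_contra hne
    -- The values of Maxine are also her mean receipts when left escape pays `Mm`. If `Mm` were
    -- wrong, left escape would be null, and Mina could never receive more than `nPosInf`.
    have hle : ∀ i, q.n i ≤ G.nPosInf := by
      intro i
      have e1 := netMean_profileLaw_eq hMp hMm G.mStar (fun i => (h.pos hρ i).1)
        (fun i => (h.isBestReply_m i).eq) i
      have e2 := integral_eq_of_netMean_eq e1 (h.m_eq i).symm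
      have e3 := ae_eq_zero_of_integral_mul e2 (sub_ne_zero.2 hne) (integrable_terminalPay 0 1 0 _)
        (terminalPay_mem (A := Set.Ici 0) _ _ _ (by simp) (by simp) (by simp))
        (terminalPay_sub_left _ _ _ _)
      rw [← EReal.coe_le_coe_iff, h.n_eq i]
      refine netMean_le_of_ae_le (integrable_terminalPay _ _ _ _) ?_
      filter_upwards [e3] with X hX
      have := G.nStar_lt
      unfold terminalPay at hX ⊢
      split_ifs at hX ⊢ <;> linarith
    exact absurd (le_of_tendsto' hNm hle) (not_le.2 G.n_lt)
  have hNp' : Np = G.nPosInf := by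
    by_contra hne
    have hle : ∀ i, q.m i ≤ G.mNegInf := by
      intro i
      have e1 := netMean_profileLaw_eq hNp hNm G.nStar (fun i => (h.pos hρ i).2)
        (fun i => by rw [← (h.isBestReply_n i).eq, G.rightProb_eq_one_sub (q.a i)]; ring) i
      have e2 := integral_eq_of_netMean_eq e1 (h.n_eq i).symm
      have e3 := ae_eq_zero_of_integral_mul e2 (sub_ne_zero.2 hne) (integrable_terminalPay 1 0 0 _)
        (terminalPay_mem (A := Set.Ici 0) _ _ _ (by simp) (by simp) (by simp))
        (terminalPay_sub_right _ _ _ _)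
      rw [← EReal.coe_le_coe_iff, h.m_eq i]
      refine netMean_le_of_ae_le (integrable_terminalPay _ _ _ _) ?_
      filter_upwards [e3] with X hX
      have := G.mStar_lt
      unfold terminalPay at hX ⊢
      split_ifs at hX ⊢ <;> linarith
    exact absurd (le_of_tendsto' hMp hle) (not_le.2 G.m_lt)
  subst hMm' hNp'
  exact ⟨hMm, hMp, hNm, hNp⟩

end IsEquilibrium

end Quadruple

theorem theorem1p6 (G : TrailGame) (hρ : G.ρ ≤ 1) :
    (∀ Sm Sp : Strategy, Sm.IsTimeInvariant → Sp.IsTimeInvariant → G.IsNash Sm Sp →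
      ∃ q : Quadruple, q.IsAssociated G Sm Sp ∧ q.IsABMN G.κ G.ρ ∧ q.HasBoundaryData G) ∧
    (∀ q : Quadruple, q.IsABMN G.κ G.ρ → q.HasBoundaryData G →
      G.IsNash (Strategy.ofProfile q.b) (Strategy.ofProfile q.a)) := by
  refine ⟨fun Sm Sp hSm hSp hN => ?_, fun q hq hb => hq.isNash hb hρ⟩
  rw [← hSm.ofProfile_profile, ← hSp.ofProfile_profile] at hN ⊢
  obtain ⟨m, n, hm, hn⟩ := hN.exists_coe_eq
  have h : Quadruple.IsEquilibrium G ⟨Sp.profile, Sm.profile, m, n⟩ := ⟨hN, hm, hn⟩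
  exact ⟨_, ⟨fun _ _ => rfl, fun _ _ => rfl, hm, hn⟩, h.isABMN hρ, h.hasBoundaryData hρ⟩
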